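/- Let $T$ be a compactly generated triangulated category with set-indexed coproducts and suspension $\Sigma$, let $R=\bigoplus_{n\in\mathbb Z}R_n$ be a $\mathbb Z$-graded ring that is noetherian and graded-commutative ($rs=(-1)^{|r||s|}sr$ for homogeneous $r,s$), and let $R$ act on $T$ through a homomorphism of graded rings $R\to Z^*(T)$ to the graded centre, where $Z^n(T)=\{\eta\colon \mathrm{Id}_T\to\Sigma^n\mid \eta\Sigma=(-1)^n\Sigma\eta\}$. Thus $\mathrm{Hom}^*_T(C,X)=\bigoplus_{n}\mathrm{Hom}_T(C,\Sigma^nX)$ is a graded $R$-module for all objects $C,X$. A *localising subcategory* of $T$ is a full triangulated subcategory closed under set-indexed coproducts; $\mathrm{Loc}_T(\mathcal C)$ is the smallest one containing the class of objects $\mathcal C$. Let $\mathrm{Spec}\,R$ be the set of homogeneous prime ideals of $R$. For a specialisation closed subset $V\subseteq\mathrm{Spec}\,R$ let $T_V$ be the localising subcategory of those $X$ with $\mathrm{Hom}^*_T(C,X)_{\mathfrak p}=0$ for all compact $C$ and all $\mathfrak p\in\mathrm{Spec}\,R\setminus V$, and let $\Gamma_VX\to X\to L_VX\to\Sigma\Gamma_VX$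 be the associated localisation triangle: the exact triangle, unique up to isomorphism, with $\Gamma_VX\in T_V$ and $\mathrm{Hom}_T(Y,L_VX)=0$ for all $Y\in T_V$. For $\mathfrak p\in\mathrm{Spec}\,R$ put $\mathcal V(\mathfrak p)=\{\mathfrak q\mid\mathfrak p\subseteq\mathfrak q\}$, $\mathcal Z(\mathfrak p)=\{\mathfrak q\mid\mathfrak q\not\subseteq\mathfrak p\}$ and $\Gamma_{\mathfrak p}X=\Gamma_{\mathcal V(\mathfrak p)}(L_{\mathcal Z(\mathfrak p)}X)$, let $\Gamma_{\mathfrak p}T$ be the essential image of $\Gamma_{\mathfrak p}$, and let $\mathrm{supp}_RT=\{\mathfrak p\in\mathrm{Spec}\,R\mid\Gamma_{\mathfrak p}T\neq0\}$. Assume the *local-global principle*: for each object $X$ of $T$, $\mathrm{Loc}_T(X)=\mathrm{Loc}_T(\Gamma_{\mathfrak p}X\mid\mathfrak p\in\mathrm{Spec}\,R)$. Then the assignments $$\sigma(S)=(S\cap\Gamma_{\mathfrak p}T)_{\mathfrak p\in\mathrm{supp}_RT},\qquad \tau\big((S(\mathfrak p))_{\mathfrak p\in\mathrm{supp}_RT}\big)=\mathrm{Loc}_T\big(S(\mathfrak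 p)\mid\mathfrak p\in\mathrm{supp}_RT\big)$$ are well-defined, mutually inverse, inclusion-preserving bijections between the localising subcategories of $T$ and the families $(S(\mathfrak p))_{\mathfrak p\in\mathrm{supp}_RT}$ in which each $S(\mathfrak p)$ is a localising subcategory of $\Gamma_{\mathfrak p}T$ (families being ordered componentwise by inclusion). -/

import Mathlib

open CategoryTheory CategoryTheory.Limits CategoryTheory.Pretriangulated

universe w v u

namespace RLinearTriangulated

section GradedRings

variable {R : Type w} [Ring R] (𝒜 : ℤ → AddSubgroup R) [GradedRing 𝒜]

/-- A `ℤ`-graded ring is graded-commutative when `r s = (-1)^(|r||s|) s r` for all homogeneous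
elements `r`, `s`. -/
def GradedCommutative : Prop :=
  ∀ (m n : ℤ) (r s : R), r ∈ 𝒜 m → s ∈ 𝒜 n → r * s = (m * n).negOnePow • (s * r)

/-- `Spec R` for a graded-commutative ring `R`: the homogeneous prime ideals. (In a
graded-commutative ring each homogeneous left ideal is two-sided.) -/
structure HomogeneousSpec where
  /-- the underlying homogeneous ideal -/
  ideal : HomogeneousIdeal 𝒜
  one_notMem : (1 : R) ∉ ideal
  mem_or_mem : ∀ (m n : ℤ) (r s : R), r ∈ 𝒜 m → s ∈ 𝒜 n →
    r * s ∈ ideal → r ∈ ideal ∨ s ∈ ideal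

variable {𝒜}

/-- The closed set `𝒱(𝔭)` of the homogeneous primes that contain `𝔭`. -/
def primesAbove (p : HomogeneousSpec 𝒜) : Set (HomogeneousSpec 𝒜) :=
  {q | p.ideal ≤ q.ideal}

/-- The specialisation closed set `𝒵(𝔭)` of the homogeneous primes not contained in `𝔭`. -/
def primesNotBelow (p : HomogeneousSpec 𝒜) : Set (HomogeneousSpec 𝒜) :=
  {q | ¬ q.ideal ≤ p.ideal}

end GradedRings

variable (T : Type u) [Category.{v} T] [Preadditive T] [HasShift T ℤ]

/-- The degree `n` component of the graded centre: the natural transformations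
`η : Id ⟶ Σⁿ` with `η Σ = (-1)ⁿ Σ η`, where `ΣⁿΣ` and `ΣΣⁿ` are identified by the canonical
isomorphism. -/
def gradedCentre [(shiftFunctor T (1 : ℤ)).Additive] (n : ℤ) :
    AddSubgroup (𝟭 T ⟶ shiftFunctor T n) where
  carrier := {η | ∀ X : T,
    η.app (X⟦(1 : ℤ)⟧) = n.negOnePow • ((η.app X)⟦(1 : ℤ)⟧' ≫ (shiftComm X n (1 : ℤ)).hom)}
  zero_mem' X := by simp
  add_mem' {a b} ha hb X := by
    have h : (a + b).app X = a.app X + b.app X := rfl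
    have h' : (a + b).app (X⟦(1 : ℤ)⟧) = a.app (X⟦(1 : ℤ)⟧) + b.app (X⟦(1 : ℤ)⟧) := rfl
    rw [h, h', ha X, hb X, Functor.map_add, Preadditive.add_comp, smul_add]
  neg_mem' {a} ha X := by
    have h : (-a).app X = -a.app X := rfl
    have h' : (-a).app (X⟦(1 : ℤ)⟧) = -a.app (X⟦(1 : ℤ)⟧) := rfl
    rw [h, h', ha X, Functor.map_neg, Preadditive.neg_comp, smul_neg]

/-- The component at `X` of an element of degree `n` of the graded centre, as an element of
`Endⁿ(X) = Hom(X, Σⁿ X)`. -/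
def gradedCentreAt [(shiftFunctor T (1 : ℤ)).Additive] {n : ℤ} (η : gradedCentre T n)
    (X : T) : ShiftedHom X X n :=
  η.1.app X

/-- An action of the graded ring `R = ⨁ₙ 𝒜 n` on `T`: a homomorphism of graded rings from `R`
to the graded centre of `T`, given by its homogeneous components. The product in the graded
centre is computed objectwise in `End*(X)`, in which `g · f` is `f` followed by `g`. -/
structure CentralAction [(shiftFunctor T (1 : ℤ)).Additive]
    {R : Type w} [Ring R] (𝒜 : ℤ → AddSubgroup R) [GradedRing 𝒜] where
  /-- the homogeneous components of the homomorphism -/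
  toFun (n : ℤ) : 𝒜 n →+ gradedCentre T n
  map_one (X : T) :
    gradedCentreAt T (toFun 0 ⟨1, SetLike.GradedOne.one_mem⟩) X = (shiftFunctorZero T ℤ).inv.app X
  map_mul (m n : ℤ) (r : 𝒜 m) (s : 𝒜 n) (X : T) :
    gradedCentreAt T (toFun (m + n) ⟨r.1 * s.1, SetLike.GradedMul.mul_mem r.2 s.2⟩) X =
      ShiftedHom.comp (gradedCentreAt T (toFun n s) X) (gradedCentreAt T (toFun m r) X) rfl

variable {T}

section Subcategories

variable [HasZeroObject T] [∀ n : ℤ, (shiftFunctor T n).Additive] [Pretriangulated T]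

/-- A localising subcategory: a (strictly) full triangulated subcategory that is closed under
all set-indexed coproducts. -/
structure IsLocalising (S : ObjectProperty T) : Prop where
  isTriangulated : S.IsTriangulated
  isClosedUnderIsomorphisms : S.IsClosedUnderIsomorphisms
  isClosedUnderCoproducts : ∀ J : Type v, S.IsClosedUnderColimitsOfShape (Discrete J)

variable (T) in
/-- The localising subcategories of `T`, ordered by inclusion. -/
abbrev LocalisingSubcategory : Type u := {S : ObjectProperty T // IsLocalising S}

/-- For a localising subcategory `P` of `T`, the localising subcategories of `P`, ordered by
inclusion. Triangles and coproducts of `P` being those of `T`, these are the localising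
subcategories of `T` contained in `P`. -/
abbrev LocalisingSubcategoryOf (P : ObjectProperty T) : Type u :=
  {S : ObjectProperty T // IsLocalising S ∧ S ≤ P}

/-- `Loc(P)`: the smallest localising subcategory that contains the class of objects `P`. -/
def loc (P : ObjectProperty T) : ObjectProperty T :=
  fun X => ∀ S : ObjectProperty T, IsLocalising S → P ≤ S → S X

end Subcategories

/-- An object `C` is compact when each morphism from `C` to a set-indexed coproduct factors
through a finite subcoproduct. -/
def IsCompactObj [HasCoproducts.{v} T] (C : T) : Prop :=
  ∀ (J : Type v) (Y : J → T) (f : C ⟶ ∐ Y), ∃ (s : Finset J) (g : C ⟶ ∐ fun j : s => Y j),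
    g ≫ Sigma.desc (fun j : s => Sigma.ι Y j) = f

variable (T) in
/-- `T` is compactly generated: `T = Loc(G)` for some set `G` of compact objects. -/
def CompactlyGenerated [HasCoproducts.{v} T] [HasZeroObject T]
    [∀ n : ℤ, (shiftFunctor T n).Additive] [Pretriangulated T] : Prop :=
  ∃ (ι : Type v) (G : ι → T), (∀ i, IsCompactObj (G i)) ∧
    loc (ObjectProperty.ofObj G) = ⊤

section LocalCohomology

variable [HasCoproducts.{v} T] [HasZeroObject T] [∀ n : ℤ, (shiftFunctor T n).Additive]
  [Pretriangulated T] {R : Type w} [Ring R] {𝒜 : ℤ → AddSubgroup R} [GradedRing 𝒜]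
  (ρ : CentralAction T 𝒜)

/-- The action of a homogeneous element `r` of degree `m` on `f ∈ Homⁿ(C, X) = Hom(C, Σⁿ X)`. -/
noncomputable def CentralAction.act {m : ℤ} (r : 𝒜 m) {C X : T} {n : ℤ} (f : ShiftedHom C X n) :
    ShiftedHom C X (m + n) :=
  f.comp (gradedCentreAt T (ρ.toFun m r) X) rfl

/-- `Hom*(C, X)_𝔭 = 0`: the homogeneous localisation at `𝔭` of the graded `R`-module
`Hom*(C, X)` vanishes, i.e. each homogeneous element is annihilated by some homogeneous
element outside `𝔭`. -/
def HomLocalisationVanishes (p : HomogeneousSpec 𝒜) (C X : T) : Prop :=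
  ∀ (n : ℤ) (f : ShiftedHom C X n), ∃ (m : ℤ) (r : 𝒜 m), r.1 ∉ p.ideal ∧ ρ.act r f = 0

/-- The `V`-torsion objects: those `X` with `Hom*(C, X)_𝔭 = 0` for all compact `C` and all
`𝔭 ∉ V`. -/
def torsion (V : Set (HomogeneousSpec 𝒜)) : ObjectProperty T :=
  fun X => ∀ C : T, IsCompactObj C → ∀ p : HomogeneousSpec 𝒜, p ∉ V →
    HomLocalisationVanishes ρ p C X

/-- `G ⟶ X ⟶ L ⟶` is, up to isomorphism, the localisation triangle
`Γ_V X ⟶ X ⟶ L_V X ⟶` of `X` for a specialisation closed set `V`: it is an exact triangle in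
which `G` is `V`-torsion and `L` lies in the right orthogonal of the `V`-torsion objects. (Such
a triangle is unique up to unique isomorphism. As the `V`-torsion objects are closed under
suspensions, the orthogonal needs no mention of them.) -/
def IsLocalisationTriangle (V : Set (HomogeneousSpec 𝒜)) (G X L : T) : Prop :=
  torsion ρ V G ∧ (torsion ρ V).rightOrthogonal L ∧
    ∃ (a : G ⟶ X) (b : X ⟶ L) (c : L ⟶ G⟦(1 : ℤ)⟧), Triangle.mk a b c ∈ distTriang T

/-- `Y ≅ L_V X`. -/
def IsLocalisationOf (V : Set (HomogeneousSpec 𝒜)) (X Y : T) : Prop :=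
  ∃ G : T, IsLocalisationTriangle ρ V G X Y

/-- `Y ≅ Γ_V X`, for the local cohomology functor `Γ_V`. -/
def IsColocalisationOf (V : Set (HomogeneousSpec 𝒜)) (X Y : T) : Prop :=
  ∃ L : T, IsLocalisationTriangle ρ V Y X L

/-- `Y ≅ Γ_𝔭 X`, where `Γ_𝔭 X = Γ_{𝒱(𝔭)} (X_𝔭)` and `X_𝔭 = L_{𝒵(𝔭)} X`. -/
def IsGamma (p : HomogeneousSpec 𝒜) (X Y : T) : Prop :=
  ∃ Xp : T, IsLocalisationOf ρ (primesNotBelow p) X Xp ∧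
    IsColocalisationOf ρ (primesAbove p) Xp Y

/-- `Γ_𝔭 T`, the essential image of `Γ_𝔭`. -/
def gammaImage (p : HomogeneousSpec 𝒜) : ObjectProperty T :=
  fun Y => ∃ X : T, IsGamma ρ p X Y

/-- `supp_R T = {𝔭 ∈ Spec R ∣ Γ_𝔭 T ≠ 0}`. -/
def supp : Set (HomogeneousSpec 𝒜) :=
  {p | ∃ Y : T, gammaImage ρ p Y ∧ ¬ IsZero Y}

/-- The local-global principle: for each object `X`, the localising subcategory generated by
`X` is the one generated by the objects `Γ_𝔭 X` with `𝔭 ∈ Spec R`. -/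
def LocalGlobalPrinciple : Prop :=
  ∀ X : T, loc (ObjectProperty.singleton X) =
    loc (fun Y : T => ∃ p : HomogeneousSpec 𝒜, IsGamma ρ p X Y)

end LocalCohomology

end RLinearTriangulated

/-!
For each prime `𝔭`, the subcategory `Γ_𝔭 T` consists of the `𝒱(𝔭)`-torsion objects that are right
orthogonal to the `𝒵(𝔭)`-torsion ones: `Γ_𝔭` lands in `𝒱(𝔭)`-torsion by construction, and the second
condition means that every homogeneous `r ∉ 𝔭` acts invertibly, a property that passes from `X` to
`Γ_V X`.

The torsion classes for `𝒱(𝔭)` and `𝒵(𝔭)` have sets of compact generators. For `𝒵(𝔭)` these are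
the cones of the elements `r ∉ 𝔭` acting on the generators of `T`. For `𝒱(𝔭)` one forms iterated
(Koszul) cones on finitely many homogeneous generators of `𝔭`; they detect zero objects because,
over a noetherian ring, every nonzero morphism has a multiple whose annihilator is prime. Being an
orthogonal of compact objects, the right orthogonal of such a torsion class is localising.

Let `A` and `B` be the `𝒵(𝔭)`- and `𝒱(𝔭)`-torsion classes. Given a family `S`, every `S(𝔮)` with
`𝔮 ≠ 𝔭` lies in `A` (if `𝔮 ⊈ 𝔭`) or in `C = B^⊥ ∩ A^⊥` (if `𝔮 ⊊ 𝔭`). The iterated extensions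
`A ∗ S(𝔭) ∗ C` form a localising subcategory, because there are no morphisms from left to right in
this product, and its intersection with `Γ_𝔭 T = B ∩ A^⊥` is `S(𝔭)`. This is `σ ∘ τ = 1`, while
`τ ∘ σ = 1` is immediate from the local-global principle.
-/

namespace RLinearTriangulated

open ZeroObject

section Localising

variable {T : Type u} [Category.{v} T]

lemma isClosedUnderColimitsOfShape_discrete {J : Type*} [HasColimitsOfShape (Discrete J) T]
    {S : ObjectProperty T} [S.IsClosedUnderIsomorphisms]
    (h : ∀ Y : J → T, (∀ j, S (Y j)) → S (∐ Y)) :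
    S.IsClosedUnderColimitsOfShape (Discrete J) where
  colimitsOfShape_le _ := fun ⟨p⟩ =>
    S.prop_of_iso
      ((HasColimit.isoOfNatIso (Discrete.natIsoFunctor (F := p.diag))).symm ≪≫
        (colimit.isColimit _).coconePointUniqueUpToIso p.isColimit)
      (h (fun j => p.diag.obj ⟨j⟩) fun j => p.prop_diag_obj ⟨j⟩)

lemma rightOrthogonal_antitone [HasZeroMorphisms T] {P Q : ObjectProperty T} (h : P ≤ Q) :
    Q.rightOrthogonal ≤ P.rightOrthogonal :=
  fun _ hY _ f hX => hY f (h _ hX)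

variable [Preadditive T] [HasShift T ℤ] [HasZeroObject T] [∀ n : ℤ, (shiftFunctor T n).Additive]
  [Pretriangulated T] {S : ObjectProperty T}

lemma isLocalising_of_sigma [HasCoproducts.{v} T] [S.IsTriangulated] [S.IsClosedUnderIsomorphisms]
    (h : ∀ (J : Type v) (Y : J → T), (∀ j, S (Y j)) → S (∐ Y)) : IsLocalising S :=
  ⟨inferInstance, inferInstance, fun J => isClosedUnderColimitsOfShape_discrete (h J)⟩

namespace IsLocalising

lemma prop_of_iso (h : IsLocalising S) {X Y : T} (e : X ≅ Y) (hX : S X) : S Y :=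
  have := h.isClosedUnderIsomorphisms
  S.prop_of_iso e hX

lemma prop_of_isZero (h : IsLocalising S) {X : T} (hX : IsZero X) : S X := by
  obtain ⟨_, _, -⟩ := h
  exact S.prop_of_isZero hX

lemma prop_shift (h : IsLocalising S) {X : T} (hX : S X) (n : ℤ) : S (X⟦n⟧) :=
  have := h.isTriangulated
  S.le_shift n _ hX

lemma prop_sigma [HasCoproducts.{v} T] (h : IsLocalising S) {J : Type v} (Y : J → T)
    (hY : ∀ j, S (Y j)) : S (∐ Y) :=
  have := h.isClosedUnderCoproducts J
  S.prop_colimit _ fun j => hY j.as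

lemma ext₂ (h : IsLocalising S) {t : Triangle T} (ht : t ∈ distTriang T)
    (h₁ : S t.obj₁) (h₃ : S t.obj₃) : S t.obj₂ := by
  obtain ⟨_, _, -⟩ := h
  exact S.ext_of_isTriangulatedClosed₂ t ht h₁ h₃

lemma ext₃ (h : IsLocalising S) {t : Triangle T} (ht : t ∈ distTriang T)
    (h₁ : S t.obj₁) (h₂ : S t.obj₂) : S t.obj₃ := by
  obtain ⟨_, _, -⟩ := h
  exact S.ext_of_isTriangulatedClosed₃ t ht h₁ h₂

protected lemma iInf {ι : Sort*} {S : ι → ObjectProperty T} (h : ∀ i, IsLocalising (S i)) :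
    IsLocalising (⨅ i, S i) := by
  have mem_iff (X : T) : (⨅ i, S i) X ↔ ∀ i, S i X := by simp
  have : (⨅ i, S i).IsClosedUnderIsomorphisms :=
    ⟨fun e hX => (mem_iff _).2 fun i => (h i).prop_of_iso e ((mem_iff _).1 hX i)⟩
  have : (⨅ i, S i).ContainsZero :=
    ⟨0, isZero_zero T, (mem_iff _).2 fun i => (h i).prop_of_isZero (isZero_zero T)⟩
  have : (⨅ i, S i).IsStableUnderShift ℤ :=
    ⟨fun n => ⟨fun X hX => (mem_iff _).2 fun i => (h i).prop_shift ((mem_iff _).1 hX i) n⟩⟩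
  have : (⨅ i, S i).IsTriangulatedClosed₂ :=
    .mk' fun t ht h₁ h₃ => (mem_iff _).2 fun i =>
      (h i).ext₂ ht ((mem_iff _).1 h₁ i) ((mem_iff _).1 h₃ i)
  refine ⟨{}, inferInstance, fun J => ⟨fun X hX => (mem_iff _).2 fun i => ?_⟩⟩
  have := (h i).isClosedUnderCoproducts J
  exact ObjectProperty.IsClosedUnderColimitsOfShape.colimitsOfShape_le _ _ _
    (ObjectProperty.colimitsOfShape_monotone _ (iInf_le S i) _ hX)

protected lemma inf {S' : ObjectProperty T} (h : IsLocalising S) (h' : IsLocalising S') :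
    IsLocalising (S ⊓ S') := by
  rw [inf_eq_iInf]
  exact .iInf (by rintro (_ | _) <;> assumption)

end IsLocalising

lemma isLocalising_loc (P : ObjectProperty T) : IsLocalising (loc P) := by
  have : loc P = ⨅ S : {S : ObjectProperty T // IsLocalising S ∧ P ≤ S}, S.1 := by
    ext X
    simp [loc]
  rw [this]
  exact .iInf fun S => S.2.1

lemma le_loc (P : ObjectProperty T) : P ≤ loc P :=
  fun _ hX _ _ hS => hS _ hX

lemma loc_le {P : ObjectProperty T} (hS : IsLocalising S) (h : P ≤ S) : loc P ≤ S :=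
  fun _ hX => hX S hS h

lemma loc_mono {P Q : ObjectProperty T} (h : P ≤ Q) : loc P ≤ loc Q :=
  loc_le (isLocalising_loc Q) (h.trans (le_loc Q))

end Localising

section Coproducts

variable {T : Type u} [Category.{v} T] [Preadditive T] [HasShift T ℤ] [HasZeroObject T]
  [∀ n : ℤ, (shiftFunctor T n).Additive] [Pretriangulated T]

lemma exists_distinguished_of_iso {t : Triangle T} (ht : t ∈ distTriang T) {X Y Z : T}
    (e₁ : X ≅ t.obj₁) (e₂ : Y ≅ t.obj₂) (e₃ : Z ≅ t.obj₃) :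
    ∃ (f : X ⟶ Y) (g : Y ⟶ Z) (h : Z ⟶ X⟦(1 : ℤ)⟧), Triangle.mk f g h ∈ distTriang T :=
  ⟨e₁.hom ≫ t.mor₁ ≫ e₂.inv, e₂.hom ≫ t.mor₂ ≫ e₃.inv, e₃.hom ≫ t.mor₃ ≫ e₁.inv⟦1⟧',
    isomorphic_distinguished _ ht _ <| by
      refine Triangle.isoMk _ _ e₁ e₂ e₃ ?_ ?_ ?_
      · change (e₁.hom ≫ t.mor₁ ≫ e₂.inv) ≫ e₂.hom = e₁.hom ≫ t.mor₁
        simp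
      · change (e₂.hom ≫ t.mor₂ ≫ e₃.inv) ≫ e₃.hom = e₂.hom ≫ t.mor₂
        simp
      · change (e₃.hom ≫ t.mor₃ ≫ e₁.inv⟦1⟧') ≫ e₁.hom⟦1⟧' = e₃.hom ≫ t.mor₃
        simp [← Functor.map_comp]⟩

open scoped CategoryTheory.Pretriangulated.Opposite in
lemma exists_distinguished_sigma {J : Type*} [HasColimitsOfShape (Discrete J) T]
    {X Y Z : J → T} {f : ∀ j, X j ⟶ Y j} {g : ∀ j, Y j ⟶ Z j} {h : ∀ j, Z j ⟶ (X j)⟦(1 : ℤ)⟧}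
    (ht : ∀ j, Triangle.mk (f j) (g j) (h j) ∈ distTriang T) :
    ∃ (f : ∐ X ⟶ ∐ Y) (g : ∐ Y ⟶ ∐ Z) (h : ∐ Z ⟶ (∐ X)⟦(1 : ℤ)⟧),
      Triangle.mk f g h ∈ distTriang T :=
  exists_distinguished_of_iso
    (unop_distinguished _ (productTriangle_distinguished _ fun j => op_distinguished _ (ht j)))
    (opCoproductIsoProduct X).symm.unop (opCoproductIsoProduct Y).symm.unop
    (opCoproductIsoProduct Z).symm.unop

end Coproducts

section Extensions

variable {T : Type u} [Category.{v} T] [Preadditive T] [HasShift T ℤ] [HasZeroObject T]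
  [∀ n : ℤ, (shiftFunctor T n).Additive] [Pretriangulated T] {P Q : ObjectProperty T}

lemma extensionProduct_swap [P.IsStableUnderShift ℤ] (hPQ : Q ≤ P.rightOrthogonal) :
    Q.extensionProduct P ≤ P.extensionProduct Q := by
  rintro X ⟨Y, Z, f, g, h, ht, hY, hZ⟩
  have h_zero : h = 0 := P.rightOrthogonal.le_shift 1 _ (hPQ _ hY) h hZ
  obtain ⟨e, -, -⟩ := exists_iso_binaryBiproduct_of_distTriang _ ht h_zero
  exact (P.extensionProduct Q).prop_of_iso (biprod.braiding _ _ ≪≫ e.symm)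
    ⟨_, _, _, _, _, binaryBiproductTriangle_distinguished Z Y, hZ, hY⟩

lemma extensionProduct_extensionProduct_le [IsTriangulated T] [P.IsTriangulated]
    [Q.IsTriangulated] [P.IsClosedUnderIsomorphisms] [Q.IsClosedUnderIsomorphisms]
    (hPQ : Q ≤ P.rightOrthogonal) :
    (P.extensionProduct Q).extensionProduct (P.extensionProduct Q) ≤ P.extensionProduct Q :=
  calc (P.extensionProduct Q).extensionProduct (P.extensionProduct Q)
    _ = P.extensionProduct ((Q.extensionProduct P).extensionProduct Q) := by
      simp only [ObjectProperty.extensionProduct_assoc]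
    _ ≤ P.extensionProduct ((P.extensionProduct Q).extensionProduct Q) :=
      ObjectProperty.monotone_extensionProduct_right _
        (ObjectProperty.monotone_extensionProduct_left _ (extensionProduct_swap hPQ))
    _ = (P.extensionProduct P).extensionProduct (Q.extensionProduct Q) := by
      simp only [ObjectProperty.extensionProduct_assoc]
    _ ≤ (P.extensionProduct P).extensionProduct Q :=
      ObjectProperty.monotone_extensionProduct_right _
        (ObjectProperty.extensionProduct_le_of_isTriangulatedClosed₂ le_rfl le_rfl)
    _ ≤ P.extensionProduct Q :=
      ObjectProperty.monotone_extensionProduct_left _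
        (ObjectProperty.extensionProduct_le_of_isTriangulatedClosed₂ le_rfl le_rfl)

lemma IsLocalising.extensionProduct [HasCoproducts.{v} T] [IsTriangulated T]
    (hP : IsLocalising P) (hQ : IsLocalising Q) (hPQ : Q ≤ P.rightOrthogonal) :
    IsLocalising (P.extensionProduct Q) := by
  obtain ⟨_, _, -⟩ := id hP
  obtain ⟨_, _, -⟩ := id hQ
  have : (P.extensionProduct Q).ContainsZero :=
    ⟨0, isZero_zero T, ObjectProperty.le_extensionProduct_left _ _
      (hP.prop_of_isZero (isZero_zero T))⟩
  have : (P.extensionProduct Q).IsTriangulatedClosed₂ :=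
    .mk' fun t ht h₁ h₃ =>
      extensionProduct_extensionProduct_le hPQ _ ⟨_, _, _, _, _, ht, h₁, h₃⟩
  have : (P.extensionProduct Q).IsTriangulated := {}
  refine isLocalising_of_sigma fun J Y hY => ?_
  choose A B f g h ht hA hB using hY
  obtain ⟨f', g', h', ht'⟩ := exists_distinguished_sigma ht
  exact ⟨_, _, _, _, _, ht', hP.prop_sigma A hA, hQ.prop_sigma B hB⟩

lemma extensionProduct_inf_rightOrthogonal_le [P.IsStableUnderShift ℤ]
    [Q.IsClosedUnderIsomorphisms] (hPQ : Q ≤ P.rightOrthogonal) :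
    P.extensionProduct Q ⊓ P.rightOrthogonal ≤ Q := by
  rintro X ⟨⟨Y, Z, f, g, h, ht, hY, hZ⟩, hX⟩
  have hY' : P.rightOrthogonal Y :=
    P.rightOrthogonal.ext_of_isTriangulatedClosed₁ _ ht hX (hPQ _ hZ)
  have : IsIso g :=
    (Triangle.isZero₁_iff_isIso₂ _ ht).1 ((IsZero.iff_id_eq_zero Y).2 (hY' _ hY))
  exact Q.prop_of_iso (asIso g).symm hZ

lemma extensionProduct_inf_le {B : ObjectProperty T} [P.IsClosedUnderIsomorphisms]
    [B.IsTriangulated] [B.IsClosedUnderIsomorphisms] (hPB : P ≤ B)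
    (hQB : Q ≤ B.rightOrthogonal) : P.extensionProduct Q ⊓ B ≤ P := by
  rintro X ⟨⟨Y, Z, f, g, h, ht, hY, hZ⟩, hX⟩
  have hZ' : B Z := B.ext_of_isTriangulatedClosed₃ _ ht (hPB _ hY) hX
  have : IsIso f :=
    (Triangle.isZero₃_iff_isIso₁ _ ht).1 ((IsZero.iff_id_eq_zero Z).2 (hQB _ hZ _ hZ'))
  exact P.prop_of_iso (asIso f) hY

lemma loc_sup_inf_le [HasCoproducts.{v} T] [IsTriangulated T] {A B C S : ObjectProperty T}
    (hA : IsLocalising A) (hB : IsLocalising B) (hC : IsLocalising C) (hS : IsLocalising S)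
    (hSB : S ≤ B ⊓ A.rightOrthogonal) (hCB : C ≤ B.rightOrthogonal ⊓ A.rightOrthogonal) :
    loc (A ⊔ S ⊔ C) ⊓ (B ⊓ A.rightOrthogonal) ≤ S := by
  obtain ⟨hSB, hSA⟩ := le_inf_iff.1 hSB
  obtain ⟨hCB, hCA⟩ := le_inf_iff.1 hCB
  have hSC : IsLocalising (S.extensionProduct C) :=
    hS.extensionProduct hC (hCB.trans (rightOrthogonal_antitone hSB))
  obtain ⟨_, _, -⟩ := id hA
  obtain ⟨_, _, -⟩ := hB
  have := hS.isClosedUnderIsomorphisms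
  obtain ⟨_, _, -⟩ := id hSC
  have hSCA : S.extensionProduct C ≤ A.rightOrthogonal :=
    ObjectProperty.extensionProduct_le_of_isTriangulatedClosed₂ hSA hCA
  obtain ⟨_, _, -⟩ := id hC
  obtain ⟨_, _, -⟩ := id hS
  have h_loc : loc (A ⊔ S ⊔ C) ≤ A.extensionProduct (S.extensionProduct C) :=
    have h_right := ObjectProperty.le_extensionProduct_right (Q := S.extensionProduct C) A
    loc_le (hA.extensionProduct hSC hSCA) (sup_le
      (sup_le (ObjectProperty.le_extensionProduct_left _)
        ((ObjectProperty.le_extensionProduct_left C).trans h_right))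
      ((ObjectProperty.le_extensionProduct_right S).trans h_right))
  rintro X ⟨hX, hXB, hXA⟩
  exact extensionProduct_inf_le hSB hCB _
    ⟨extensionProduct_inf_rightOrthogonal_le hSCA _ ⟨h_loc _ hX, hXA⟩, hXB⟩

end Extensions

section Shift

lemma exists_eq_comp_shift_map {T : Type u} [Category.{v} T] {A : Type*} [AddGroup A]
    [HasShift T A] {X Y : T} {n : A} (f : X ⟶ Y⟦n⟧) :
    ∃ g : X⟦-n⟧ ⟶ Y, f = (shiftNegShift X n).inv ≫ g⟦n⟧' :=
  ⟨(shiftFunctor T n).preimage ((shiftNegShift X n).hom ≫ f), by simp⟩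

end Shift

section Compact

variable {T : Type u} [Category.{v} T] [Preadditive T] [HasCoproducts.{v} T]

lemma isCompactObj_iff (C : T) : IsCompactObj C ↔
    ∀ (J : Type v) (Y : J → T) (f : C ⟶ ∐ Y), ∃ s : Finset J,
      ∀ (W : T) (g : ∐ Y ⟶ W), (∀ j ∈ s, Sigma.ι Y j ≫ g = 0) → f ≫ g = 0 := by
  classical
  refine ⟨fun h J Y f => ?_, fun h J Y f => ?_⟩
  · obtain ⟨s, f', rfl⟩ := h J Y f
    refine ⟨s, fun W g hg => ?_⟩
    have h_desc : Sigma.desc (fun j : s => Sigma.ι Y j) ≫ g = 0 :=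
      Sigma.hom_ext _ _ fun j => by simpa using hg j j.2
    rw [Category.assoc, h_desc, comp_zero]
  · obtain ⟨s, hs⟩ := h J Y f
    let q : ∐ Y ⟶ ∐ fun j : s => Y j :=
      Sigma.desc fun j => if hj : j ∈ s then Sigma.ι (fun j : s => Y j) ⟨j, hj⟩ else 0
    have h_fix := hs _ (q ≫ Sigma.desc (fun j : s => Sigma.ι Y j) - 𝟙 _) fun j hj => by
      simp [q, hj]
    rw [Preadditive.comp_sub, Category.comp_id, sub_eq_zero] at h_fix
    exact ⟨s, f ≫ q, by rw [Category.assoc, h_fix]⟩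

instance : ObjectProperty.IsClosedUnderIsomorphisms (IsCompactObj (T := T)) where
  of_iso e hC := by
    rw [isCompactObj_iff] at hC ⊢
    intro J Y f
    obtain ⟨s, hs⟩ := hC J Y (e.hom ≫ f)
    exact ⟨s, fun W g hg => by simpa using hs W g hg⟩

namespace IsCompactObj

lemma exists_eq_sum {C : T} (hC : IsCompactObj C) {J : Type v} {Y : J → T}
    (f : C ⟶ ∐ Y) : ∃ (s : Finset J) (g : ∀ j, C ⟶ Y j), f = ∑ j ∈ s, g j ≫ Sigma.ι Y j := by
  classical
  obtain ⟨s, hs⟩ := (isCompactObj_iff C).1 hC J Y f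
  refine ⟨s, fun j => f ≫ Sigma.π Y j, ?_⟩
  have h := hs _ (𝟙 _ - ∑ j ∈ s, Sigma.π Y j ≫ Sigma.ι Y j) fun j hj => by
    rw [Preadditive.comp_sub, Category.comp_id, Preadditive.comp_sum,
      Finset.sum_eq_single_of_mem j hj, Sigma.ι_π_eq_id_assoc, sub_self]
    intro k _ hk
    rw [Sigma.ι_π_of_ne_assoc _ hk.symm, zero_comp]
  rw [Preadditive.comp_sub, Category.comp_id, sub_eq_zero, Preadditive.comp_sum] at h
  simpa only [Category.assoc] using h

variable [HasShift T ℤ] [∀ n : ℤ, (shiftFunctor T n).Additive]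

lemma shift {C : T} (hC : IsCompactObj C) (n : ℤ) : IsCompactObj (C⟦n⟧) := by
  rw [isCompactObj_iff] at hC ⊢
  intro J Y f
  let c := sigmaComparison (shiftFunctor T (-n)) Y
  obtain ⟨s, hs⟩ := hC J _ ((shiftShiftNeg C n).inv ≫ f⟦-n⟧' ≫ inv c)
  refine ⟨s, fun W g hg => ?_⟩
  have h := hs _ (c ≫ g⟦-n⟧') fun j hj => by
    rw [ι_comp_sigmaComparison_assoc, ← Functor.map_comp, hg j hj, Functor.map_zero]
  simp only [Category.assoc, IsIso.inv_hom_id_assoc, ← Functor.map_comp] at h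
  rw [Preadditive.IsIso.comp_left_eq_zero] at h
  exact (shiftFunctor T (-n)).map_eq_zero_iff.1 h

lemma shiftClosure_ofObj_le {J : Type*} {G : J → T} (hG : ∀ j, IsCompactObj (G j)) :
    (ObjectProperty.ofObj G).shiftClosure ℤ ≤ IsCompactObj := by
  have : ObjectProperty.IsStableUnderShift (IsCompactObj (T := T)) ℤ :=
    ⟨fun n => ⟨fun _ hC => hC.shift n⟩⟩
  rw [ObjectProperty.shiftClosure_le_iff]
  rintro _ ⟨j⟩
  exact hG j

variable [HasZeroObject T] [Pretriangulated T]

lemma cone {C₁ C₂ C₃ : T} {a : C₁ ⟶ C₂} {b : C₂ ⟶ C₃} {c : C₃ ⟶ C₁⟦(1 : ℤ)⟧}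
    (ht : Triangle.mk a b c ∈ distTriang T) (h₁ : IsCompactObj C₁) (h₂ : IsCompactObj C₂) :
    IsCompactObj C₃ := by
  classical
  replace h₁ := h₁.shift 1
  rw [isCompactObj_iff] at h₁ h₂ ⊢
  intro J Y f
  obtain ⟨s, hs⟩ := h₂ J Y (b ≫ f)
  let π : ∐ Y ⟶ ∐ Y := Sigma.desc fun j => if j ∈ s then Sigma.ι Y j else 0
  have hbf : b ≫ f ≫ (𝟙 _ - π) = 0 := by
    rw [← Category.assoc]
    exact hs _ _ fun j hj => by simp [π, hj]
  obtain ⟨k, hk⟩ : ∃ k : C₁⟦(1 : ℤ)⟧ ⟶ ∐ Y, f ≫ (𝟙 _ - π) = c ≫ k :=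
    Triangle.yoneda_exact₃ _ ht _ hbf
  obtain ⟨t, ht⟩ := h₁ J Y k
  refine ⟨s ∪ t, fun W g hg => ?_⟩
  have hπ : π ≫ g = 0 := Sigma.hom_ext _ _ fun j => by
    by_cases hj : j ∈ s
    · simpa [π, hj] using hg j (Finset.mem_union_left _ hj)
    · simp [π, hj]
  have hk' : k ≫ g = 0 := ht _ g fun j hj => hg j (Finset.mem_union_right _ hj)
  calc f ≫ g = (f ≫ (𝟙 _ - π)) ≫ g := by
        rw [Category.assoc, Preadditive.sub_comp, hπ, sub_zero, Category.id_comp]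
    _ = 0 := by rw [hk, Category.assoc, hk', comp_zero]

end IsCompactObj

end Compact

section Generators

variable {T : Type u} [Category.{v} T] [Preadditive T]

/-- A `K`-ghost: a morphism that is annihilated by precomposition with every morphism from an
object of `K`. -/
def IsGhost (K : ObjectProperty T) {X Y : T} (f : X ⟶ Y) : Prop :=
  ∀ ⦃A : T⦄ (g : A ⟶ X), K A → g ≫ f = 0

lemma isGhost_sigma_desc [HasCoproducts.{v} T] {K : ObjectProperty T} (hK : K ≤ IsCompactObj)
    {I : Type v} {X : I → T} {Y : T} {f : ∀ i, X i ⟶ Y} (hf : ∀ i, IsGhost K (f i)) :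
    IsGhost K (Sigma.desc f) := by
  intro A g hA
  obtain ⟨s, g, rfl⟩ := (hK _ hA).exists_eq_sum g
  rw [Preadditive.sum_comp]
  exact Finset.sum_eq_zero fun i _ => by rw [Category.assoc, Sigma.ι_desc, hf i (g i) hA]

lemma IsGhost.comp {K : ObjectProperty T} {X Y Z : T} {f : X ⟶ Y} (hf : IsGhost K f)
    (g : Y ⟶ Z) : IsGhost K (f ≫ g) :=
  fun A a hA => by rw [← Category.assoc, hf a hA, zero_comp]

lemma rightOrthogonal_sigma [HasCoproducts.{v} T] {K : ObjectProperty T} (hK : K ≤ IsCompactObj)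
    {I : Type v} {Y : I → T} (hY : ∀ i, K.rightOrthogonal (Y i)) : K.rightOrthogonal (∐ Y) := by
  intro A f hA
  obtain ⟨s, g, rfl⟩ := (hK _ hA).exists_eq_sum f
  exact Finset.sum_eq_zero fun i _ => by rw [hY i (g i) hA, zero_comp]

variable [HasShift T ℤ]

/-- The objects `Y` with `Hom*(G j, Y) = 0` for all `j`. -/
def gradedOrthogonal {J : Type*} (G : J → T) : ObjectProperty T :=
  ((ObjectProperty.ofObj G).shiftClosure ℤ).rightOrthogonal

lemma gradedOrthogonal_iff {J : Type*} {G : J → T} {Y : T} :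
    gradedOrthogonal G Y ↔ ∀ (j : J) (n : ℤ) (f : (G j)⟦n⟧ ⟶ Y), f = 0 := by
  refine ⟨fun h j n f => h f ⟨_, n, Iso.refl _, ⟨j⟩⟩, ?_⟩
  rintro h A f ⟨_, n, e, ⟨j⟩⟩
  rw [← cancel_epi e.inv, h j n (e.inv ≫ f), comp_zero]

variable [∀ n : ℤ, (shiftFunctor T n).Additive]

lemma gradedOrthogonal_iff_shift {J : Type*} {G : J → T} {Y : T} :
    gradedOrthogonal G Y ↔ ∀ (j : J) (n : ℤ) (f : G j ⟶ Y⟦n⟧), f = 0 := by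
  rw [gradedOrthogonal_iff]
  refine ⟨fun h j n f => ?_, fun h j n f => (shiftFunctor T (-n)).map_eq_zero_iff.1 ?_⟩
  · obtain ⟨g, rfl⟩ := exists_eq_comp_shift_map f
    rw [h j _ g, Functor.map_zero, comp_zero]
  · exact (Preadditive.IsIso.comp_left_eq_zero _ _).1
      (h j (-n) ((shiftShiftNeg (G j) n).inv ≫ f⟦-n⟧'))

variable [HasZeroObject T] [Pretriangulated T]

lemma IsGhost.rightOrthogonal_cone_id_sub {K : ObjectProperty T} [K.IsStableUnderShift ℤ]
    {X L : T} {θ : X ⟶ X} (hθ : IsGhost K θ) {q : X ⟶ L} {δ : L ⟶ X⟦(1 : ℤ)⟧}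
    (ht : Triangle.mk (𝟙 X - θ) q δ ∈ distTriang T) : K.rightOrthogonal L := by
  have hq : (𝟙 X - θ) ≫ q = 0 := comp_distTriang_mor_zero₁₂ _ ht
  have hδ : δ ≫ (𝟙 X - θ)⟦(1 : ℤ)⟧' = 0 := comp_distTriang_mor_zero₃₁ _ ht
  intro A g hA
  have h_shift : (g ≫ δ) ≫ θ⟦(1 : ℤ)⟧' = 0 := by
    obtain ⟨k, hk⟩ := exists_eq_comp_shift_map (g ≫ δ)
    rw [hk, Category.assoc, ← Functor.map_comp, hθ k (K.le_shift (-1) _ hA), Functor.map_zero,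
      comp_zero]
  have hgδ : g ≫ δ = 0 := by
    have h : (g ≫ δ) ≫ (𝟙 X - θ)⟦(1 : ℤ)⟧' = 0 := by rw [Category.assoc, hδ, comp_zero]
    rwa [Functor.map_sub, CategoryTheory.Functor.map_id, Preadditive.comp_sub, Category.comp_id,
      h_shift, sub_zero] at h
  obtain ⟨l, rfl⟩ : ∃ l : A ⟶ X, g = l ≫ q := Triangle.coyoneda_exact₃ _ ht g hgδ
  have hl : l ≫ (𝟙 X - θ) = l := by
    rw [Preadditive.comp_sub, Category.comp_id, hθ l hA, sub_zero]
  rw [← hl, Category.assoc, hq, comp_zero]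

variable [HasCoproducts.{v} T] {J : Type v} {G : J → T} {P : ObjectProperty T}

lemma isLocalising_gradedOrthogonal (hG : ∀ j, IsCompactObj (G j)) :
    IsLocalising (gradedOrthogonal G) := by
  unfold gradedOrthogonal
  exact isLocalising_of_sigma fun _ _ =>
    rightOrthogonal_sigma (IsCompactObj.shiftClosure_ofObj_le hG)

/-- The objects `G j` are compact generators of `P`: they are compact objects of `P` which detect
whether an object of `P` is zero. -/
structure IsCompactGenerators (P : ObjectProperty T) (G : J → T) : Prop where
  isCompactObj (j : J) : IsCompactObj (G j)
  prop (j : J) : P (G j)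
  isZero {X : T} (hX : P X) (h : gradedOrthogonal G X) : IsZero X

lemma exists_ghost_extension (hP : IsLocalising P) (hGP : ∀ j, P (G j)) {W Y : T} (hW : P W)
    (hY : gradedOrthogonal G Y) (f : W ⟶ Y) :
    ∃ (W' : T) (i : W ⟶ W') (f' : W' ⟶ Y), P W' ∧
      IsGhost ((ObjectProperty.ofObj G).shiftClosure ℤ) i ∧ i ≫ f' = f := by
  let K (x : Σ (j : J) (n : ℤ), ((G j)⟦n⟧ ⟶ W)) : T := (G x.1)⟦x.2.1⟧
  let k : ∐ K ⟶ W := Sigma.desc fun x => x.2.2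
  obtain ⟨W', i, c, ht⟩ := distinguished_cocone_triangle k
  have hki : k ≫ i = 0 := comp_distTriang_mor_zero₁₂ _ ht
  have hkf : k ≫ f = 0 := Sigma.hom_ext _ _ fun x => by
    rw [comp_zero]
    exact gradedOrthogonal_iff.1 hY _ _ _
  obtain ⟨f', hf'⟩ : ∃ f' : W' ⟶ Y, f = i ≫ f' := Triangle.yoneda_exact₂ _ ht f hkf
  refine ⟨W', i, f', hP.ext₃ ht (hP.prop_sigma K fun x => hP.prop_shift (hGP _) _) hW, ?_,
    hf'.symm⟩
  rintro A g ⟨_, n, e, ⟨j⟩⟩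
  have hg : Sigma.ι K ⟨j, n, e.inv ≫ g⟩ ≫ k = e.inv ≫ g := Sigma.ι_desc _ _
  rw [← cancel_epi e.inv, comp_zero, ← Category.assoc, ← hg, Category.assoc, hki, comp_zero]

lemma exists_ghost_sequence (hP : IsLocalising P) (hGP : ∀ j, P (G j)) {X Y : T} (hX : P X)
    (hY : gradedOrthogonal G Y) (f : X ⟶ Y) :
    ∃ (W : ℕ → T) (i : ∀ k, W k ⟶ W (k + 1)) (φ : ∀ k, W k ⟶ Y) (a : X ⟶ W 0),
      (∀ k, P (W k)) ∧ (∀ k, IsGhost ((ObjectProperty.ofObj G).shiftClosure ℤ) (i k)) ∧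
        (∀ k, i k ≫ φ (k + 1) = φ k) ∧ a ≫ φ 0 = f := by
  choose next i φ hnext hi hφ using fun S : {S : Over Y // P S.left} =>
    exists_ghost_extension hP hGP S.2 hY S.1.hom
  let S (k : ℕ) : {S : Over Y // P S.left} :=
    Nat.rec ⟨Over.mk f, hX⟩ (fun _ S => ⟨Over.mk (φ S), hnext S⟩) k
  exact ⟨fun k => (S k).1.left, fun k => i (S k), fun k => (S k).1.hom, 𝟙 X, fun k => (S k).2,
    fun k => hi (S k), fun k => hφ (S k), Category.id_comp f⟩

namespace IsCompactGenerators

lemma rightOrthogonal_of_gradedOrthogonal (hG : IsCompactGenerators P G) (hP : IsLocalising P)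
    {Y : T} (hY : gradedOrthogonal G Y) : P.rightOrthogonal Y := by
  intro X f hX
  obtain ⟨W, i, φ, a, hW, hi, hφ, rfl⟩ := exists_ghost_sequence hP hG.prop hX hY f
  -- The mapping telescope of `W` is the cone `L` of `1 - θ`. It is zero because the transition maps
  -- are ghosts, so that the maps `φ k`, which coequalise `1` and `θ`, vanish.
  let M (k : ULift.{v} ℕ) : T := W k.down
  let θ : ∐ M ⟶ ∐ M := Sigma.desc fun k => i k.down ≫ Sigma.ι M ⟨k.down + 1⟩
  have hθ : IsGhost _ θ := isGhost_sigma_desc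
    (IsCompactObj.shiftClosure_ofObj_le hG.isCompactObj) fun k => (hi k.down).comp _
  obtain ⟨L, q, δ, ht⟩ := distinguished_cocone_triangle (𝟙 (∐ M) - θ)
  have hM : P (∐ M) := hP.prop_sigma M fun k => hW k.down
  have hL : IsZero L := hG.isZero (hP.ext₃ ht hM hM) (hθ.rightOrthogonal_cone_id_sub ht)
  have : IsIso (𝟙 (∐ M) - θ) := (Triangle.isZero₃_iff_isIso₁ _ ht).1 hL
  have h_desc : Sigma.desc (fun k : ULift.{v} ℕ => φ k.down) = (0 : ∐ M ⟶ Y) := by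
    rw [← cancel_epi (𝟙 (∐ M) - θ), comp_zero]
    refine Sigma.hom_ext _ _ fun k => ?_
    rw [Preadditive.sub_comp, Category.id_comp, Preadditive.comp_sub, Sigma.ι_desc,
      Sigma.ι_desc_assoc, Category.assoc, Sigma.ι_desc, hφ, sub_self, comp_zero]
  have hφ₀ : φ 0 = 0 := by
    rw [← Sigma.ι_desc (f := M) (fun k => φ k.down) ⟨0⟩, h_desc, comp_zero]
  rw [hφ₀, comp_zero]

lemma rightOrthogonal_eq (hG : IsCompactGenerators P G) (hP : IsLocalising P) :
    P.rightOrthogonal = gradedOrthogonal G := by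
  refine le_antisymm (rightOrthogonal_antitone ?_)
    fun _ hY => hG.rightOrthogonal_of_gradedOrthogonal hP hY
  obtain ⟨_, _, -⟩ := hP
  rw [ObjectProperty.shiftClosure_le_iff]
  rintro _ ⟨j⟩
  exact hG.prop j

lemma isLocalising_rightOrthogonal (hG : IsCompactGenerators P G) (hP : IsLocalising P) :
    IsLocalising P.rightOrthogonal := by
  rw [hG.rightOrthogonal_eq hP]
  exact isLocalising_gradedOrthogonal hG.isCompactObj

end IsCompactGenerators

lemma CompactlyGenerated.exists_isCompactGenerators (hT : CompactlyGenerated T) :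
    ∃ (J : Type v) (G : J → T), IsCompactGenerators ⊤ G := by
  obtain ⟨J, G, hG, hloc⟩ := hT
  have h_left : IsLocalising (gradedOrthogonal G).leftOrthogonal := by
    unfold gradedOrthogonal
    exact isLocalising_of_sigma fun _ Y hY Z f hZ => Sigma.hom_ext _ _ fun j => by
      rw [hY j (Sigma.ι Y j ≫ f) hZ, comp_zero]
  have hG_left : ObjectProperty.ofObj G ≤ (gradedOrthogonal G).leftOrthogonal :=
    fun _ hA _ f hY => hY f (ObjectProperty.le_shiftClosure _ _ hA)
  refine ⟨J, G, hG, fun _ => trivial, fun {X} _ hX => (IsZero.iff_id_eq_zero X).2 ?_⟩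
  have h_top : ⊤ ≤ (gradedOrthogonal G).leftOrthogonal := hloc ▸ loc_le h_left hG_left
  exact h_top X trivial (𝟙 X) hX

end Generators

section Action

variable {T : Type u} [Category.{v} T] [Preadditive T] [HasShift T ℤ]
  [∀ n : ℤ, (shiftFunctor T n).Additive] {R : Type w} [Ring R] {𝒜 : ℤ → AddSubgroup R}
  [GradedRing 𝒜]

/-- The product of two homogeneous elements, as a homogeneous element. -/
def homogeneousMul {m n : ℤ} (r : 𝒜 m) (s : 𝒜 n) : 𝒜 (m + n) :=
  ⟨r.1 * s.1, SetLike.GradedMul.mul_mem r.2 s.2⟩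

namespace CentralAction

variable (ρ : CentralAction T 𝒜)

/-- The morphism `X ⟶ Σᵐ X` by which a homogeneous element of degree `m` acts on `X`. -/
def app {m : ℤ} (r : 𝒜 m) (X : T) : X ⟶ X⟦m⟧ :=
  (ρ.toFun m r).1.app X

lemma naturality {m : ℤ} (r : 𝒜 m) {X Y : T} (f : X ⟶ Y) :
    f ≫ ρ.app r Y = ρ.app r X ≫ f⟦m⟧' :=
  (ρ.toFun m r).1.naturality f

lemma app_zero (m : ℤ) (X : T) : ρ.app (0 : 𝒜 m) X = 0 := by
  simp only [app, map_zero]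
  rfl

lemma app_add {m : ℤ} (r s : 𝒜 m) (X : T) : ρ.app (r + s) X = ρ.app r X + ρ.app s X := by
  simp only [app, map_add]
  rfl

lemma app_one (X : T) :
    ρ.app ⟨1, SetLike.GradedOne.one_mem⟩ X = (shiftFunctorZero T ℤ).inv.app X :=
  ρ.map_one X

lemma app_mul {m n : ℤ} (r : 𝒜 m) (s : 𝒜 n) (X : T) :
    ρ.app (homogeneousMul r s) X =
      ρ.app s X ≫ (ρ.app r X)⟦n⟧' ≫ (shiftFunctorAdd' T m n (m + n) rfl).inv.app X :=
  ρ.map_mul m n r s X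

lemma comp_app_mul_eq_zero_iff {m n : ℤ} (r : 𝒜 m) (s : 𝒜 n) {A X : T} (f : A ⟶ X) :
    f ≫ ρ.app (homogeneousMul r s) X = 0 ↔ f ≫ ρ.app r X ≫ ρ.app s (X⟦m⟧) = 0 := by
  rw [app_mul, naturality, ← Category.assoc, ← Category.assoc, ← Category.assoc,
    Preadditive.IsIso.comp_right_eq_zero]

lemma app_shift_one {m : ℤ} (r : 𝒜 m) (X : T) :
    ρ.app r (X⟦(1 : ℤ)⟧) =
      m.negOnePow • ((ρ.app r X)⟦(1 : ℤ)⟧' ≫ (shiftFunctorComm T m 1).hom.app X) :=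
  (ρ.toFun m r).2 X

lemma shift_map_app_succ_comp {m : ℤ} (r : 𝒜 m) (X : T) (n : ℤ) :
    (ρ.app r X)⟦n + 1⟧' ≫ (shiftFunctorComm T m (n + 1)).hom.app X ≫
        ((shiftFunctorAdd T n 1).hom.app X)⟦m⟧' =
      (shiftFunctorAdd T n 1).hom.app X ≫
        ((ρ.app r X)⟦n⟧' ≫ (shiftFunctorComm T m n).hom.app X)⟦(1 : ℤ)⟧' ≫
          (shiftFunctorComm T m 1).hom.app (X⟦n⟧) := by
  rw [shiftFunctorComm_hom_app_comp_shift_shiftFunctorAdd_hom_app, Functor.map_comp,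
    Category.assoc]
  exact (shiftFunctorAdd T n 1).hom.naturality_assoc (ρ.app r X) _

lemma app_shift_succ_comp {m : ℤ} (r : 𝒜 m) (X : T) (n : ℤ) :
    ρ.app r (X⟦n + 1⟧) ≫ ((shiftFunctorAdd T n 1).hom.app X)⟦m⟧' =
      m.negOnePow • ((shiftFunctorAdd T n 1).hom.app X ≫ (ρ.app r (X⟦n⟧))⟦(1 : ℤ)⟧' ≫
          (shiftFunctorComm T m 1).hom.app (X⟦n⟧)) := by
  rw [← naturality]
  change _ ≫ ρ.app r (X⟦n⟧⟦(1 : ℤ)⟧) = _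
  rw [app_shift_one, Linear.comp_units_smul]

lemma app_shift_succ_iff {m : ℤ} (r : 𝒜 m) (X : T) (n : ℤ) :
    ρ.app r (X⟦n + 1⟧) = (m * (n + 1)).negOnePow •
        ((ρ.app r X)⟦n + 1⟧' ≫ (shiftFunctorComm T m (n + 1)).hom.app X) ↔
      ρ.app r (X⟦n⟧) =
        (m * n).negOnePow • ((ρ.app r X)⟦n⟧' ≫ (shiftFunctorComm T m n).hom.app X) := by
  have h_sign : (m * (n + 1)).negOnePow = m.negOnePow * (m * n).negOnePow := by
    rw [mul_add, mul_one, Int.negOnePow_add, mul_comm]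
  rw [← cancel_mono (((shiftFunctorAdd T n 1).hom.app X)⟦m⟧'), app_shift_succ_comp,
    Linear.units_smul_comp, Category.assoc, shift_map_app_succ_comp, h_sign, mul_smul,
    (MulAction.injective m.negOnePow).eq_iff, ← Linear.comp_units_smul, ← Linear.units_smul_comp,
    cancel_epi, cancel_mono, ← Functor.map_units_smul]
  exact (shiftFunctor T (1 : ℤ)).map_injective.eq_iff

lemma app_shift_zero {m : ℤ} (r : 𝒜 m) (X : T) :
    ρ.app r (X⟦(0 : ℤ)⟧) = (ρ.app r X)⟦(0 : ℤ)⟧' ≫ (shiftFunctorComm T m 0).hom.app X := by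
  rw [shiftFunctorComm_zero_hom_app]
  calc ρ.app r (X⟦(0 : ℤ)⟧)
    _ = (shiftFunctorZero T ℤ).hom.app X ≫ (shiftFunctorZero T ℤ).inv.app X ≫
          ρ.app r (X⟦(0 : ℤ)⟧) := ((shiftFunctorZero T ℤ).hom_inv_id_app_assoc X _).symm
    _ = (shiftFunctorZero T ℤ).hom.app X ≫ ρ.app r X ≫
          ((shiftFunctorZero T ℤ).inv.app X)⟦m⟧' :=
        congrArg _ (ρ.naturality r ((shiftFunctorZero T ℤ).inv.app X))
    _ = (ρ.app r X)⟦(0 : ℤ)⟧' ≫ (shiftFunctorZero T ℤ).hom.app (X⟦m⟧) ≫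
          ((shiftFunctorZero T ℤ).inv.app X)⟦m⟧' :=
        ((shiftFunctorZero T ℤ).hom.naturality_assoc (ρ.app r X) _).symm

lemma app_shift {m : ℤ} (r : 𝒜 m) (X : T) (n : ℤ) :
    ρ.app r (X⟦n⟧) =
      (m * n).negOnePow • ((ρ.app r X)⟦n⟧' ≫ (shiftFunctorComm T m n).hom.app X) := by
  induction n using Int.induction_on with
  | zero => rw [mul_zero, Int.negOnePow_zero, one_smul, app_shift_zero]
  | succ k hk => exact (ρ.app_shift_succ_iff r X k).2 hk
  | pred k hk =>
    refine (ρ.app_shift_succ_iff r X (-k - 1)).1 ?_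
    rwa [sub_add_cancel]

lemma app_shift_self {m : ℤ} (r : 𝒜 m) (X : T) :
    ρ.app r (X⟦m⟧) = (m * m).negOnePow • (ρ.app r X)⟦m⟧' := by
  rw [app_shift, shiftFunctorComm_eq_refl]
  exact congrArg _ (Category.comp_id _)

lemma comp_app_shift_eq_zero_iff {m : ℤ} (r : 𝒜 m) {A X : T} {n : ℤ} (f : A ⟶ X⟦n⟧) :
    f ≫ ρ.app r (X⟦n⟧) = 0 ↔ f ≫ (ρ.app r X)⟦n⟧' = 0 := by
  rw [app_shift, Linear.comp_units_smul, smul_eq_zero_iff_eq, ← Category.assoc,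
    Preadditive.IsIso.comp_right_eq_zero]

lemma act_eq_zero_iff {m n : ℤ} (r : 𝒜 m) {C X : T} (f : ShiftedHom C X n) :
    ρ.act r f = 0 ↔ f ≫ (ρ.app r X)⟦n⟧' = 0 := by
  change f ≫ (ρ.app r X)⟦n⟧' ≫ _ = 0 ↔ _
  rw [← Category.assoc, Preadditive.IsIso.comp_right_eq_zero]

lemma isIso_app_of_comp_eq_id {m : ℤ} (r : 𝒜 m) {X : T} (s : X⟦m⟧ ⟶ X)
    (hs : ρ.app r X ≫ s = 𝟙 X) : IsIso (ρ.app r X) := by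
  have h_left : s ≫ ρ.app r X = (m * m).negOnePow • 𝟙 (X⟦m⟧) := by
    rw [naturality, app_shift_self, Linear.units_smul_comp, ← Functor.map_comp, hs,
      CategoryTheory.Functor.map_id]
  have : IsSplitMono (ρ.app r X) := ⟨⟨s, hs⟩⟩
  have : IsSplitEpi (ρ.app r X) := ⟨⟨(m * m).negOnePow • s, by
    rw [Linear.units_smul_comp, h_left, smul_smul, Int.units_mul_self, one_smul]⟩⟩
  exact isIso_of_mono_of_isSplitEpi _

lemma eq_zero_of_app_eq_zero {m : ℤ} {r : 𝒜 m} {X Y : T} [IsIso (ρ.app r Y)]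
    (h : ρ.app r X = 0) (f : X ⟶ Y) : f = 0 := by
  rw [← cancel_mono (ρ.app r Y), ρ.naturality, h, zero_comp, zero_comp]

end CentralAction

end Action

section Annihilator

variable {T : Type u} [Category.{v} T] [Preadditive T] [HasShift T ℤ]
  [∀ n : ℤ, (shiftFunctor T n).Additive] {R : Type w} [Ring R] {𝒜 : ℤ → AddSubgroup R}
  [GradedRing 𝒜] (ρ : CentralAction T 𝒜)

open DirectSum in
/-- The annihilator of a morphism `f`, as a homogeneous ideal of `R`: the elements whose
homogeneous components all annihilate `f`. -/
def annihilator {A X : T} (f : A ⟶ X) : HomogeneousIdeal 𝒜 where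
  carrier := {r | ∀ n, f ≫ ρ.app (decompose 𝒜 r n) X = 0}
  zero_mem' n := by rw [decompose_zero, DirectSum.zero_apply, ρ.app_zero, comp_zero]
  add_mem' {a b} ha hb n := by
    rw [decompose_add, DirectSum.add_apply, ρ.app_add, Preadditive.comp_add, ha, hb, add_zero]
  smul_mem' r a ha := by
    induction r using DirectSum.Decomposition.inductionOn 𝒜 with
    | zero => simp [ρ.app_zero]
    | add r s hr hs =>
      intro n
      rw [add_smul, decompose_add, DirectSum.add_apply, ρ.app_add, Preadditive.comp_add, hr, hs,
        add_zero]
    | @homogeneous i r =>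
      intro n
      obtain ⟨j, rfl⟩ : ∃ j, n = i + j := ⟨n - i, by ring⟩
      have h_mul : decompose 𝒜 ((r : R) • a) (i + j) = homogeneousMul r (decompose 𝒜 a j) :=
        Subtype.ext (coe_decompose_mul_add_of_left_mem 𝒜 r.2)
      rw [h_mul, ρ.app_mul, reassoc_of% ha j, zero_comp]
  is_homogeneous' i a ha n := by
    by_cases h : i = n
    · subst h
      rw [decompose_coe, of_eq_same]
      exact ha i
    · rw [decompose_coe, of_eq_of_ne _ _ _ (Ne.symm h), ρ.app_zero, comp_zero]

variable {ρ}

open DirectSum in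
lemma mem_annihilator_iff {A X : T} {f : A ⟶ X} {m : ℤ} (r : 𝒜 m) :
    (r : R) ∈ annihilator ρ f ↔ f ≫ ρ.app r X = 0 := by
  refine ⟨fun h => ?_, fun h n => ?_⟩
  · have hm := h m
    rwa [decompose_coe, of_eq_same] at hm
  · by_cases hn : m = n
    · subst hn
      rwa [decompose_coe, of_eq_same]
    · rw [decompose_coe, of_eq_of_ne _ _ _ (Ne.symm hn), ρ.app_zero, comp_zero]

lemma annihilator_le_iff {A X : T} {f : A ⟶ X} {I : HomogeneousIdeal 𝒜} :
    annihilator ρ f ≤ I ↔ ∀ (m : ℤ) (r : 𝒜 m), f ≫ ρ.app r X = 0 → r.1 ∈ I := by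
  classical
  refine ⟨fun h m r hr => h ((mem_annihilator_iff r).2 hr), fun h r hr => ?_⟩
  rw [← DirectSum.sum_support_decompose 𝒜 r]
  exact sum_mem fun n _ => h n _ (hr n)

lemma annihilator_le_annihilator {A X A' X' : T} {f : A ⟶ X} {g : A' ⟶ X'}
    (h : ∀ (m : ℤ) (r : 𝒜 m), f ≫ ρ.app r X = 0 → g ≫ ρ.app r X' = 0) :
    annihilator ρ f ≤ annihilator ρ g :=
  annihilator_le_iff.2 fun m r hr => (mem_annihilator_iff r).2 (h m r hr)

lemma one_mem_annihilator_iff {A X : T} {f : A ⟶ X} : (1 : R) ∈ annihilator ρ f ↔ f = 0 := by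
  refine (mem_annihilator_iff (⟨1, SetLike.GradedOne.one_mem⟩ : 𝒜 0)).trans ?_
  rw [ρ.app_one, Preadditive.IsIso.comp_right_eq_zero]

lemma annihilator_le_annihilator_comp {A X Y : T} (f : A ⟶ X) (g : X ⟶ Y) :
    annihilator ρ f ≤ annihilator ρ (f ≫ g) :=
  annihilator_le_annihilator fun m r hr => by
    rw [Category.assoc, ρ.naturality, reassoc_of% hr, zero_comp]

lemma annihilator_comp_of_isIso {A X Y : T} (f : A ⟶ X) (g : X ⟶ Y) [IsIso g] :
    annihilator ρ (f ≫ g) = annihilator ρ f := by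
  refine le_antisymm ?_ (annihilator_le_annihilator_comp f g)
  simpa using annihilator_le_annihilator_comp (ρ := ρ) (f ≫ g) (inv g)

lemma annihilator_isIso_comp_shift_map {A B X : T} {n : ℤ} (e : A ⟶ B⟦n⟧) [IsIso e]
    (f : B ⟶ X) : annihilator ρ (e ≫ f⟦n⟧') = annihilator ρ f := by
  have h_iff {m : ℤ} (r : 𝒜 m) :
      (e ≫ f⟦n⟧') ≫ ρ.app r (X⟦n⟧) = 0 ↔ f ≫ ρ.app r X = 0 := by
    rw [ρ.comp_app_shift_eq_zero_iff, Category.assoc, Preadditive.IsIso.comp_left_eq_zero,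
      ← Functor.map_comp, Functor.map_eq_zero_iff]
  exact le_antisymm (annihilator_le_annihilator fun m r => (h_iff r).1)
    (annihilator_le_annihilator fun m r => (h_iff r).2)

lemma annihilator_comp_app_le {A X : T} {f : A ⟶ X} {p : HomogeneousSpec 𝒜}
    (hf : annihilator ρ f ≤ p.ideal) {m : ℤ} {r : 𝒜 m} (hr : r.1 ∉ p.ideal) :
    annihilator ρ (f ≫ ρ.app r X) ≤ p.ideal :=
  annihilator_le_iff.2 fun n s hs => by
    rw [Category.assoc, ← ρ.comp_app_mul_eq_zero_iff] at hs
    exact (p.mem_or_mem m n r s r.2 s.2 (annihilator_le_iff.1 hf _ _ hs)).resolve_left hr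

lemma annihilator_le_or_of_add {A X : T} {f g : A ⟶ X} {p : HomogeneousSpec 𝒜}
    (h : annihilator ρ (f + g) ≤ p.ideal) :
    annihilator ρ f ≤ p.ideal ∨ annihilator ρ g ≤ p.ideal := by
  rw [or_iff_not_imp_left, annihilator_le_iff (f := f)]
  push Not
  rintro ⟨m, r, hfr, hr⟩
  have h_comp : annihilator ρ ((f + g) ≫ ρ.app r X) ≤ p.ideal := annihilator_comp_app_le h hr
  rw [Preadditive.add_comp, hfr, zero_add] at h_comp
  exact (annihilator_le_annihilator_comp g _).trans h_comp

lemma exists_annihilator_le_of_sum {A X : T} {J : Type*} {s : Finset J} {f : J → (A ⟶ X)}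
    {p : HomogeneousSpec 𝒜} (h : annihilator ρ (∑ j ∈ s, f j) ≤ p.ideal) :
    ∃ j ∈ s, annihilator ρ (f j) ≤ p.ideal := by
  classical
  induction s using Finset.induction_on with
  | empty => exact (p.one_notMem (h (one_mem_annihilator_iff.2 Finset.sum_empty))).elim
  | insert j s hj ih =>
    rw [Finset.sum_insert hj] at h
    rcases annihilator_le_or_of_add h with hj | hs
    · exact ⟨j, Finset.mem_insert_self j s, hj⟩
    · obtain ⟨k, hk, hkp⟩ := ih hs
      exact ⟨k, Finset.mem_insert_of_mem hk, hkp⟩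

lemma exists_annihilator_eq_ideal [IsNoetherianRing R] {A X : T} {n : ℤ} {f : A ⟶ X⟦n⟧}
    (hf : f ≠ 0) :
    ∃ (k : ℤ) (g : A ⟶ X⟦k⟧) (p : HomogeneousSpec 𝒜), annihilator ρ g = p.ideal := by
  obtain ⟨I, ⟨k, g, hg, rfl⟩, h_max⟩ :=
    (InvImage.wf (HomogeneousIdeal.toIdeal (𝒜 := 𝒜)) wellFounded_gt).has_min
      {I | ∃ (k : ℤ) (g : A ⟶ X⟦k⟧), g ≠ 0 ∧ annihilator ρ g = I} ⟨_, n, f, hf, rfl⟩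
  refine ⟨k, g, ⟨annihilator ρ g, fun h => hg (one_mem_annihilator_iff.1 h), ?_⟩, rfl⟩
  intro m l r s hr hs hrs
  rw [or_iff_not_imp_left]
  intro hgr
  let g' : A ⟶ X⟦k + m⟧ := (g ≫ ρ.app ⟨r, hr⟩ _) ≫ (shiftFunctorAdd T k m).inv.app X
  have h_annihilator : annihilator ρ g' = annihilator ρ (g ≫ ρ.app ⟨r, hr⟩ _) :=
    annihilator_comp_of_isIso _ _
  have h_le : annihilator ρ g ≤ annihilator ρ g' :=
    h_annihilator ▸ annihilator_le_annihilator_comp g _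
  have hg' : g' ≠ 0 := by
    intro h
    rw [Preadditive.IsIso.comp_right_eq_zero] at h
    exact hgr ((mem_annihilator_iff ⟨r, hr⟩).2 h)
  have hs' : s ∈ annihilator ρ g' := by
    rw [h_annihilator]
    refine (mem_annihilator_iff ⟨s, hs⟩).2 ?_
    rw [Category.assoc, ← ρ.comp_app_mul_eq_zero_iff]
    exact (mem_annihilator_iff (homogeneousMul ⟨r, hr⟩ ⟨s, hs⟩)).1 hrs
  by_contra hsg
  exact h_max _ ⟨k + m, g', hg', rfl⟩ (lt_of_le_not_ge h_le fun h => hsg (h hs'))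

end Annihilator

section Torsion

variable {T : Type u} [Category.{v} T] [Preadditive T] [HasShift T ℤ]
  [∀ n : ℤ, (shiftFunctor T n).Additive] {R : Type w} [Ring R] {𝒜 : ℤ → AddSubgroup R}
  [GradedRing 𝒜] {ρ : CentralAction T 𝒜}

lemma homLocalisationVanishes_iff {p : HomogeneousSpec 𝒜} {C X : T} :
    HomLocalisationVanishes ρ p C X ↔
      ∀ (n : ℤ) (f : C ⟶ X⟦n⟧), ¬ annihilator ρ f ≤ p.ideal := by
  refine forall₂_congr fun n f => ?_
  rw [annihilator_le_iff]
  push Not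
  refine exists₂_congr fun m r => ?_
  rw [and_comm, ρ.act_eq_zero_iff]
  exact and_congr_left' (ρ.comp_app_shift_eq_zero_iff r f).symm

variable [HasCoproducts.{v} T] {V : Set (HomogeneousSpec 𝒜)}

lemma torsion_iff {X : T} : torsion ρ V X ↔ ∀ C : T, IsCompactObj C → ∀ (f : C ⟶ X)
    (p : HomogeneousSpec 𝒜), annihilator ρ f ≤ p.ideal → p ∈ V := by
  refine ⟨fun h C hC f p hf => ?_, fun h C hC p hp => ?_⟩
  · by_contra hp
    refine homLocalisationVanishes_iff.1 (h C hC p hp) 0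
      (f ≫ (shiftFunctorZero T ℤ).inv.app X) ?_
    rwa [annihilator_comp_of_isIso]
  · refine homLocalisationVanishes_iff.2 fun n f hf => hp ?_
    obtain ⟨g, rfl⟩ := exists_eq_comp_shift_map f
    rw [annihilator_isIso_comp_shift_map] at hf
    exact h _ (hC.shift (-n)) g p hf

lemma torsion_mono {V' : Set (HomogeneousSpec 𝒜)} (h : V ⊆ V') : torsion ρ V ≤ torsion ρ V' :=
  fun _ hX => torsion_iff.2 fun C hC f p hf => h (torsion_iff.1 hX C hC f p hf)

lemma torsion_inter (V' : Set (HomogeneousSpec 𝒜)) :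
    torsion ρ (V ∩ V') = torsion ρ V ⊓ torsion ρ V' :=
  le_antisymm (le_inf (torsion_mono Set.inter_subset_left) (torsion_mono Set.inter_subset_right))
    fun _ ⟨hX, hX'⟩ => torsion_iff.2 fun C hC f p hf =>
      ⟨torsion_iff.1 hX C hC f p hf, torsion_iff.1 hX' C hC f p hf⟩

lemma torsion_univ : torsion ρ Set.univ = ⊤ :=
  top_unique fun _ _ => torsion_iff.2 fun _ _ _ _ _ => trivial

variable (ρ V)

instance : (torsion ρ V).IsClosedUnderIsomorphisms where
  of_iso e hX := torsion_iff.2 fun C hC f p hf => torsion_iff.1 hX C hC (f ≫ e.inv) p <| by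
    rwa [annihilator_comp_of_isIso]

instance : (torsion ρ V).IsStableUnderShift ℤ where
  isStableUnderShiftBy n := ⟨fun X hX => torsion_iff.2 fun C hC f p hf => by
    obtain ⟨g, rfl⟩ := exists_eq_comp_shift_map f
    rw [annihilator_isIso_comp_shift_map] at hf
    exact torsion_iff.1 hX _ (hC.shift (-n)) g p hf⟩

variable {ρ V}

lemma torsion_sigma {J : Type v} {Y : J → T} (hY : ∀ j, torsion ρ V (Y j)) :
    torsion ρ V (∐ Y) :=
  torsion_iff.2 fun C hC f p hf => by
    obtain ⟨s, g, rfl⟩ := hC.exists_eq_sum f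
    obtain ⟨j, -, hj⟩ := exists_annihilator_le_of_sum hf
    exact torsion_iff.1 (hY j) C hC (g j) p
      ((annihilator_le_annihilator_comp (g j) (Sigma.ι Y j)).trans hj)

variable [HasZeroObject T]

instance : (torsion ρ V).ContainsZero where
  exists_zero := ⟨0, isZero_zero T, torsion_iff.2 fun _ _ f p hf =>
    (p.one_notMem (hf (one_mem_annihilator_iff.2 ((isZero_zero T).eq_of_tgt f 0)))).elim⟩

variable [Pretriangulated T]

lemma torsion_ext₂ {X₁ X₂ X₃ : T} {a : X₁ ⟶ X₂} {b : X₂ ⟶ X₃} {c : X₃ ⟶ X₁⟦(1 : ℤ)⟧}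
    (ht : Triangle.mk a b c ∈ distTriang T) (h₁ : torsion ρ V X₁) (h₃ : torsion ρ V X₃) :
    torsion ρ V X₂ :=
  torsion_iff.2 fun C hC f p hf => by
    by_cases hfb : annihilator ρ (f ≫ b) ≤ p.ideal
    · exact torsion_iff.1 h₃ C hC (f ≫ b) p hfb
    · rw [annihilator_le_iff] at hfb
      push Not at hfb
      obtain ⟨m, r, hr, hrp⟩ := hfb
      obtain ⟨k, hk⟩ := exists_eq_comp_shift_map (f ≫ ρ.app r X₂)
      have hkb : k ≫ b = 0 := by
        rw [Category.assoc, ρ.naturality, ← Category.assoc, hk, Category.assoc,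
          Preadditive.IsIso.comp_left_eq_zero, ← Functor.map_comp] at hr
        exact (shiftFunctor T m).map_eq_zero_iff.1 hr
      obtain ⟨g, rfl⟩ : ∃ g : C⟦-m⟧ ⟶ X₁, k = g ≫ a := Triangle.coyoneda_exact₂ _ ht k hkb
      have h_le := annihilator_comp_app_le hf hrp
      rw [hk, annihilator_isIso_comp_shift_map] at h_le
      exact torsion_iff.1 h₁ _ (hC.shift (-m)) g p
        ((annihilator_le_annihilator_comp g a).trans h_le)

variable (ρ V)

lemma isLocalising_torsion : IsLocalising (torsion ρ V) :=
  have : (torsion ρ V).IsTriangulatedClosed₂ := .mk' fun _ ht h₁ h₃ => torsion_ext₂ ht h₁ h₃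
  have : (torsion ρ V).IsTriangulated := {}
  isLocalising_of_sigma fun _ _ => torsion_sigma

end Torsion

section Cone

variable {T : Type u} [Category.{v} T] [Preadditive T] [HasShift T ℤ] [HasZeroObject T]
  [∀ n : ℤ, (shiftFunctor T n).Additive] [Pretriangulated T]
  {R : Type w} [Ring R] {𝒜 : ℤ → AddSubgroup R} [GradedRing 𝒜] {ρ : CentralAction T 𝒜}
  {m : ℤ} {r : 𝒜 m} {X Z : T} {b : X⟦m⟧ ⟶ Z} {c : Z ⟶ X⟦(1 : ℤ)⟧}

lemma app_mul_self_cone_eq_zero (ht : Triangle.mk (ρ.app r X) b c ∈ distTriang T) :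
    ρ.app (homogeneousMul r r) Z = 0 := by
  have hb : ρ.app r X ≫ b = 0 := comp_distTriang_mor_zero₁₂ _ ht
  have hc : c ≫ (ρ.app r X)⟦(1 : ℤ)⟧' = 0 := comp_distTriang_mor_zero₃₁ _ ht
  have hbr : b ≫ ρ.app r Z = 0 := by
    rw [ρ.naturality, ρ.app_shift_self, Linear.units_smul_comp, ← Functor.map_comp, hb,
      Functor.map_zero, smul_zero]
  have hcr : c ≫ ρ.app r (X⟦(1 : ℤ)⟧) = 0 := (ρ.comp_app_shift_eq_zero_iff r c).2 hc
  obtain ⟨w, hw⟩ : ∃ w : X⟦(1 : ℤ)⟧ ⟶ Z⟦m⟧, ρ.app r Z = c ≫ w :=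
    Triangle.yoneda_exact₃ _ ht _ hbr
  have h : ρ.app r Z ≫ ρ.app r (Z⟦m⟧) = 0 := by
    conv_lhs => rw [hw, Category.assoc, ρ.naturality, reassoc_of% hcr, zero_comp]
  rw [← Category.id_comp (ρ.app _ Z), ρ.comp_app_mul_eq_zero_iff, h, comp_zero]

lemma eq_zero_of_comp_app_eq_zero (ht : Triangle.mk (ρ.app r X) b c ∈ distTriang T) {Y : T}
    (hY : ∀ f : Z ⟶ Y⟦m⟧, f = 0) {f : X ⟶ Y} (hf : f ≫ ρ.app r Y = 0) : f = 0 := by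
  rw [ρ.naturality] at hf
  obtain ⟨l, hl⟩ : ∃ l : Z ⟶ Y⟦m⟧, f⟦m⟧' = b ≫ l := Triangle.yoneda_exact₂ _ ht _ hf
  rw [hY l, comp_zero] at hl
  exact (shiftFunctor T m).map_eq_zero_iff.1 hl

lemma torsion_cone [HasCoproducts.{v} T] (ht : Triangle.mk (ρ.app r X) b c ∈ distTriang T) :
    torsion ρ {p | r.1 ∈ p.ideal} Z :=
  torsion_iff.2 fun _ _ f p hf =>
    or_self_iff.1 <| p.mem_or_mem m m r r r.2 r.2 <|
      annihilator_le_iff.1 hf _ (homogeneousMul r r) <| by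
        rw [app_mul_self_cone_eq_zero ht, comp_zero]

end Cone

section Koszul

lemma exists_finset_homogeneous_span_eq {A ι σ : Type*} [Semiring A] [DecidableEq ι] [AddMonoid ι]
    [SetLike σ A] [AddSubmonoidClass σ A] {𝒜 : ι → σ} [GradedRing 𝒜] {I : Ideal A}
    (hI : I.IsHomogeneous 𝒜) (h_fg : I.FG) :
    ∃ t : Finset A, (∀ a ∈ t, SetLike.IsHomogeneousElem 𝒜 a) ∧ Ideal.span t = I := by
  obtain ⟨S, rfl⟩ := (Ideal.IsHomogeneous.iff_exists 𝒜 I).1 hI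
  obtain ⟨t, htS, ht⟩ := (Submodule.fg_span_iff_fg_span_finset_subset _).1 h_fg
  refine ⟨t, fun a ha => ?_, ht.symm⟩
  obtain ⟨s, -, rfl⟩ := htS ha
  exact s.2

variable {R : Type w} [Ring R] {𝒜 : ℤ → AddSubgroup R} [GradedRing 𝒜]

lemma exists_finset_primesAbove_eq [IsNoetherianRing R] (p : HomogeneousSpec 𝒜) :
    ∃ t : Finset R, (∀ r ∈ t, SetLike.IsHomogeneousElem 𝒜 r) ∧
      primesAbove p = {q | ∀ r ∈ t, r ∈ q.ideal} := by
  obtain ⟨t, ht, h_span⟩ := exists_finset_homogeneous_span_eq p.ideal.isHomogeneous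
    (IsNoetherian.noetherian p.ideal.toIdeal)
  refine ⟨t, ht, Set.ext fun q => ?_⟩
  change p.ideal.toIdeal ≤ q.ideal.toIdeal ↔ _
  rw [← h_span, Ideal.span_le]
  rfl

variable {T : Type u} [Category.{v} T] [Preadditive T] [HasShift T ℤ] [HasZeroObject T]
  [∀ n : ℤ, (shiftFunctor T n).Additive] [Pretriangulated T] [HasCoproducts.{v} T]
  {ρ : CentralAction T 𝒜}

lemma IsCompactGenerators.cone [IsNoetherianRing R] {V : Set (HomogeneousSpec 𝒜)} {J : Type v}
    {G : J → T} (hG : IsCompactGenerators (torsion ρ V) G) {m : ℤ} {r : 𝒜 m} {Z : J → T}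
    {b : ∀ j, (G j)⟦m⟧ ⟶ Z j} {c : ∀ j, Z j ⟶ (G j)⟦(1 : ℤ)⟧}
    (ht : ∀ j, Triangle.mk (ρ.app r (G j)) (b j) (c j) ∈ distTriang T) :
    IsCompactGenerators (torsion ρ (V ∩ {p | r.1 ∈ p.ideal})) Z := by
  have hZ (j : J) : IsCompactObj (Z j) :=
    .cone (ht j) (hG.isCompactObj j) ((hG.isCompactObj j).shift m)
  refine ⟨hZ, fun j => ?_, fun {X} hX h_orth => ?_⟩
  · rw [torsion_inter]
    have hV := isLocalising_torsion ρ V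
    exact ⟨hV.ext₃ (ht j) (hG.prop j) (hV.prop_shift (hG.prop j) m), torsion_cone (ht j)⟩
  refine hG.isZero (torsion_mono Set.inter_subset_left _ hX) (gradedOrthogonal_iff_shift.2 ?_)
  intro j n f
  by_contra hf
  obtain ⟨k, g, p, hp⟩ := exists_annihilator_eq_ideal (ρ := ρ) hf
  have hXk := ObjectProperty.le_shift _ k _ hX
  have hrp : r.1 ∈ p.ideal := (torsion_iff.1 hXk _ (hG.isCompactObj j) g p hp.le).2
  have hZX := gradedOrthogonal_iff_shift.1
    ((isLocalising_gradedOrthogonal hZ).prop_shift h_orth k) j m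
  rw [← hp, mem_annihilator_iff] at hrp
  exact p.one_notMem (hp ▸ one_mem_annihilator_iff.2
    (eq_zero_of_comp_app_eq_zero (ht j) hZX hrp))

variable (ρ) in
lemma CompactlyGenerated.exists_isCompactGenerators_torsion [IsNoetherianRing R]
    (hT : CompactlyGenerated T) (t : Finset R) (ht : ∀ r ∈ t, SetLike.IsHomogeneousElem 𝒜 r) :
    ∃ (J : Type v) (G : J → T),
      IsCompactGenerators (torsion ρ {p | ∀ r ∈ t, r ∈ p.ideal}) G := by
  classical
  induction t using Finset.induction_on with
  | empty =>
    simpa only [Finset.notMem_empty, IsEmpty.forall_iff, implies_true, Set.ofPred_true,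
      torsion_univ] using hT.exists_isCompactGenerators
  | insert r t _ ih =>
    rw [Finset.forall_mem_insert] at ht
    obtain ⟨⟨m, hr⟩, ht⟩ := ht
    obtain ⟨J, G, hG⟩ := ih ht
    choose Z b c h_cone using fun j => distinguished_cocone_triangle (ρ.app ⟨r, hr⟩ (G j))
    have h_eq : {p : HomogeneousSpec 𝒜 | ∀ s ∈ insert r t, s ∈ p.ideal} =
        {p | ∀ s ∈ t, s ∈ p.ideal} ∩ {p | r ∈ p.ideal} := by
      ext p
      exact Finset.forall_mem_insert _ _ _ |>.trans and_comm
    exact ⟨J, Z, h_eq ▸ hG.cone h_cone⟩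

variable (ρ) in
lemma CompactlyGenerated.isLocalising_rightOrthogonal_primesAbove [IsNoetherianRing R]
    (hT : CompactlyGenerated T) (p : HomogeneousSpec 𝒜) :
    IsLocalising (torsion ρ (primesAbove p)).rightOrthogonal := by
  obtain ⟨t, ht, h_eq⟩ := exists_finset_primesAbove_eq p
  obtain ⟨J, G, hG⟩ := hT.exists_isCompactGenerators_torsion ρ t ht
  rw [h_eq]
  exact hG.isLocalising_rightOrthogonal (isLocalising_torsion ρ _)

end Koszul

section Local

variable {T : Type u} [Category.{v} T] [Preadditive T] [HasShift T ℤ]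
  [∀ n : ℤ, (shiftFunctor T n).Additive] [HasCoproducts.{v} T]
  {R : Type w} [Ring R] {𝒜 : ℤ → AddSubgroup R} [GradedRing 𝒜] {ρ : CentralAction T 𝒜}
  {p : HomogeneousSpec 𝒜}

lemma exists_comp_app_eq_zero_of_torsion_primesNotBelow {A X : T} (hA : IsCompactObj A)
    (hX : torsion ρ (primesNotBelow p) X) (f : A ⟶ X) :
    ∃ (m : ℤ) (r : 𝒜 m), r.1 ∉ p.ideal ∧ f ≫ ρ.app r X = 0 := by
  by_contra! h
  refine torsion_iff.1 hX A hA f p (annihilator_le_iff.2 fun m r hr => ?_) le_rfl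
  by_contra hrp
  exact h m r hrp hr

variable [HasZeroObject T] [Pretriangulated T]

lemma torsion_primesNotBelow_cone {m : ℤ} {r : 𝒜 m} (hr : r.1 ∉ p.ideal) {X Z : T}
    {b : X⟦m⟧ ⟶ Z} {c : Z ⟶ X⟦(1 : ℤ)⟧} (ht : Triangle.mk (ρ.app r X) b c ∈ distTriang T) :
    torsion ρ (primesNotBelow p) Z :=
  torsion_mono (fun _ hq (hqp : _ ≤ p.ideal) => hr (hqp hq)) _ (torsion_cone ht)

variable (ρ p) in
lemma CompactlyGenerated.exists_isCompactGenerators_primesNotBelow (hT : CompactlyGenerated T) :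
    ∃ (J : Type v) (Z : J → T), IsCompactGenerators (torsion ρ (primesNotBelow p)) Z ∧
      ∀ j, ∃ (m : ℤ) (r : 𝒜 m), r.1 ∉ p.ideal ∧ ρ.app r (Z j) = 0 := by
  obtain ⟨I, G, hG⟩ := hT.exists_isCompactGenerators
  -- Cones are indexed by the morphism `e` rather than by `r`, since `R` may lie in a universe
  -- larger than `v`.
  let J : Type v := Σ (i : I) (m : ℤ),
    {e : G i ⟶ (G i)⟦m⟧ // ∃ r : 𝒜 m, r.1 ∉ p.ideal ∧ ρ.app r (G i) = e}
  choose Z b c ht using fun j : J => distinguished_cocone_triangle j.2.2.1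
  have hZ (j : J) : IsCompactObj (Z j) :=
    .cone (ht j) (hG.isCompactObj j.1) ((hG.isCompactObj j.1).shift _)
  refine ⟨J, Z, ⟨hZ, ?_, fun {X} hX h_orth => ?_⟩, ?_⟩
  · rintro ⟨i, m, e, r, hr, rfl⟩
    exact torsion_primesNotBelow_cone hr (ht ⟨i, m, ρ.app r (G i), r, hr, rfl⟩)
  · refine hG.isZero trivial (gradedOrthogonal_iff_shift.2 fun i n f => ?_)
    obtain ⟨m, r, hr, hfr⟩ := exists_comp_app_eq_zero_of_torsion_primesNotBelow
      (hG.isCompactObj i) (ObjectProperty.le_shift _ n _ hX) f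
    exact eq_zero_of_comp_app_eq_zero (ht ⟨i, m, ρ.app r (G i), r, hr, rfl⟩)
      (gradedOrthogonal_iff_shift.1
        ((isLocalising_gradedOrthogonal hZ).prop_shift h_orth n) _ m) hfr
  · rintro ⟨i, m, e, r, hr, rfl⟩
    exact ⟨_, homogeneousMul r r, fun h => hr (or_self_iff.1 (p.mem_or_mem m m r r r.2 r.2 h)),
      app_mul_self_cone_eq_zero (ht ⟨i, m, ρ.app r (G i), r, hr, rfl⟩)⟩

variable (ρ p) in
lemma CompactlyGenerated.isLocalising_rightOrthogonal_primesNotBelow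
    (hT : CompactlyGenerated T) :
    IsLocalising (torsion ρ (primesNotBelow p)).rightOrthogonal := by
  obtain ⟨J, Z, hZ, -⟩ := hT.exists_isCompactGenerators_primesNotBelow ρ p
  exact hZ.isLocalising_rightOrthogonal (isLocalising_torsion ρ _)

lemma isIso_app_of_rightOrthogonal {Y : T}
    (hY : (torsion ρ (primesNotBelow p)).rightOrthogonal Y) {m : ℤ} {r : 𝒜 m}
    (hr : r.1 ∉ p.ideal) : IsIso (ρ.app r Y) := by
  obtain ⟨Z, b, c, ht⟩ := distinguished_cocone_triangle (ρ.app r Y)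
  have hZ : (torsion ρ (primesNotBelow p)).rightOrthogonal Z :=
    ObjectProperty.ext_of_isTriangulatedClosed₃ _ _ ht hY (ObjectProperty.le_shift _ m _ hY)
  exact (Triangle.isZero₃_iff_isIso₁ _ ht).1
    ((IsZero.iff_id_eq_zero Z).2 (hZ _ (torsion_primesNotBelow_cone hr ht)))

lemma CompactlyGenerated.rightOrthogonal_primesNotBelow_iff (hT : CompactlyGenerated T) {Y : T} :
    (torsion ρ (primesNotBelow p)).rightOrthogonal Y ↔
      ∀ (m : ℤ) (r : 𝒜 m), r.1 ∉ p.ideal → IsIso (ρ.app r Y) := by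
  refine ⟨fun hY m r hr => isIso_app_of_rightOrthogonal hY hr, fun hY => ?_⟩
  obtain ⟨J, Z, hZ, h_zero⟩ := hT.exists_isCompactGenerators_primesNotBelow ρ p
  rw [hZ.rightOrthogonal_eq (isLocalising_torsion ρ _), gradedOrthogonal_iff]
  intro j n f
  obtain ⟨m, r, hr, hrZ⟩ := h_zero j
  have := hY m r hr
  have h_shift : ρ.app r ((Z j)⟦n⟧) = 0 := by
    rw [ρ.app_shift, hrZ, Functor.map_zero, zero_comp, smul_zero]
  exact ρ.eq_zero_of_app_eq_zero h_shift f

lemma isIso_app_of_isColocalisationOf {V : Set (HomogeneousSpec 𝒜)} {X Y : T}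
    (h : IsColocalisationOf ρ V X Y) {m : ℤ} (r : 𝒜 m) [IsIso (ρ.app r X)] :
    IsIso (ρ.app r Y) := by
  obtain ⟨L, hY, hL, a, b, c, ht⟩ := h
  have h_inj (k : Y ⟶ Y) (hk : k ≫ a = 0) : k = 0 := by
    obtain ⟨l, rfl⟩ : ∃ l : Y ⟶ L⟦(-1 : ℤ)⟧, k = l ≫ (Triangle.mk a b c).invRotate.mor₁ :=
      Triangle.coyoneda_exact₂ _ (inv_rot_of_distTriang _ ht) k hk
    exact (congrArg (· ≫ _) (ObjectProperty.le_shift _ (-1 : ℤ) _ hL l hY)).trans zero_comp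
  obtain ⟨s, hs⟩ : ∃ s : Y⟦m⟧ ⟶ Y, a⟦m⟧' ≫ inv (ρ.app r X) = s ≫ a :=
    Triangle.coyoneda_exact₂ _ ht _ (hL _ (ObjectProperty.le_shift _ m _ hY))
  refine ρ.isIso_app_of_comp_eq_id r s (sub_eq_zero.1 (h_inj _ ?_))
  rw [Preadditive.sub_comp, Category.assoc, ← hs, ← reassoc_of% (ρ.naturality r a),
    IsIso.hom_inv_id, Category.comp_id, Category.id_comp, sub_self]

lemma isColocalisationOf_self {V : Set (HomogeneousSpec 𝒜)} {X : T} (hX : torsion ρ V X) :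
    IsColocalisationOf ρ V X X :=
  ⟨_, hX, fun _ _ _ => (isZero_zero T).eq_of_tgt _ _, _, _, _, contractible_distinguished X⟩

lemma isLocalisationOf_self {V : Set (HomogeneousSpec 𝒜)} {X : T}
    (hX : (torsion ρ V).rightOrthogonal X) : IsLocalisationOf ρ V X X :=
  ⟨_, ObjectProperty.prop_zero _, hX, _, _, _, contractible_distinguished₁ X⟩

lemma CompactlyGenerated.gammaImage_eq (hT : CompactlyGenerated T) : gammaImage ρ p =
    torsion ρ (primesAbove p) ⊓ (torsion ρ (primesNotBelow p)).rightOrthogonal := by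
  refine le_antisymm ?_ fun Y hY => ⟨Y, Y, isLocalisationOf_self hY.2,
    isColocalisationOf_self hY.1⟩
  rintro Y ⟨X, Xp, ⟨_, -, hXp, -⟩, hY⟩
  refine ⟨hY.choose_spec.1, hT.rightOrthogonal_primesNotBelow_iff.2 fun m r hr => ?_⟩
  have := isIso_app_of_rightOrthogonal hXp hr
  exact isIso_app_of_isColocalisationOf hY r

variable (ρ p) in
lemma CompactlyGenerated.isLocalising_gammaImage (hT : CompactlyGenerated T) :
    IsLocalising (gammaImage ρ p) := by
  rw [hT.gammaImage_eq]
  exact (isLocalising_torsion ρ _).inf (hT.isLocalising_rightOrthogonal_primesNotBelow ρ p)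

end Local

section Stratification

variable {T : Type u} [Category.{v} T] [Preadditive T] [HasZeroObject T] [HasShift T ℤ]
  [∀ n : ℤ, (shiftFunctor T n).Additive] [Pretriangulated T] [HasCoproducts.{v} T]
  {R : Type w} [Ring R] {𝒜 : ℤ → AddSubgroup R} [GradedRing 𝒜] {ρ : CentralAction T 𝒜}

lemma loc_iSup_inf_gammaImage (hlg : LocalGlobalPrinciple ρ) {S : ObjectProperty T}
    (hS : IsLocalising S) : loc (⨆ p : supp ρ, S ⊓ gammaImage ρ p.1) = S := by
  refine le_antisymm (loc_le hS (iSup_le fun _ => inf_le_left)) fun X hX => ?_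
  have h_gamma_mem {Y : T} {p : HomogeneousSpec 𝒜} (hY : IsGamma ρ p X Y) : S Y := by
    refine loc_le hS (P := ObjectProperty.singleton X) (by rintro _ ⟨⟩; exact hX) Y ?_
    rw [hlg X]
    exact le_loc _ _ ⟨p, hY⟩
  have hX_loc : loc (fun Y : T => ∃ p, IsGamma ρ p X Y) X := by
    rw [← hlg X]
    exact le_loc _ _ (by simp)
  refine loc_le (isLocalising_loc _) ?_ X hX_loc
  rintro Y ⟨p, hY⟩
  by_cases hY0 : IsZero Y
  · exact (isLocalising_loc _).prop_of_isZero hY0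
  · let p' : supp ρ := ⟨p, Y, ⟨X, hY⟩, hY0⟩
    exact le_loc _ _ (le_iSup (fun p : supp ρ => S ⊓ gammaImage ρ p.1) p' Y
      ⟨h_gamma_mem hY, X, hY⟩)

variable {p q : HomogeneousSpec 𝒜}

lemma gammaImage_le_torsion_primesNotBelow (hqp : ¬ q.ideal ≤ p.ideal) :
    gammaImage ρ q ≤ torsion ρ (primesNotBelow p) := by
  rintro Y ⟨_, _, _, _, hY, -⟩
  exact torsion_mono (fun q' hq' hq'p => hqp (le_trans hq' hq'p)) _ hY

lemma gammaImage_le_rightOrthogonal_primesNotBelow (hT : CompactlyGenerated T)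
    (hqp : q.ideal ≤ p.ideal) :
    gammaImage ρ q ≤ (torsion ρ (primesNotBelow p)).rightOrthogonal := by
  rw [hT.gammaImage_eq]
  exact inf_le_right.trans
    (rightOrthogonal_antitone (torsion_mono fun q' hq' hq'q => hq' (le_trans hq'q hqp)))

lemma gammaImage_le_rightOrthogonal_primesAbove (hT : CompactlyGenerated T)
    (hpq : ¬ p.ideal ≤ q.ideal) :
    gammaImage ρ q ≤ (torsion ρ (primesAbove p)).rightOrthogonal := by
  rw [hT.gammaImage_eq]
  exact inf_le_right.trans
    (rightOrthogonal_antitone (torsion_mono fun q' hq' hq'q => hpq (le_trans hq' hq'q)))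

lemma HomogeneousSpec.ideal_injective :
    Function.Injective (HomogeneousSpec.ideal : HomogeneousSpec 𝒜 → HomogeneousIdeal 𝒜) := by
  rintro ⟨_, _, _⟩ ⟨_, _, _⟩ rfl
  rfl

lemma iSup_le_torsion_sup_rightOrthogonal (hT : CompactlyGenerated T)
    (F : (q : supp ρ) → LocalisingSubcategoryOf (gammaImage ρ q.1)) (p : supp ρ) :
    ⨆ q, (F q).1 ≤ torsion ρ (primesNotBelow p.1) ⊔ (F p).1 ⊔
      (torsion ρ (primesAbove p.1)).rightOrthogonal ⊓
        (torsion ρ (primesNotBelow p.1)).rightOrthogonal := by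
  refine iSup_le fun q => ?_
  by_cases hqp : q.1.ideal ≤ p.1.ideal
  · by_cases hpq : p.1.ideal ≤ q.1.ideal
    · obtain rfl : q = p := Subtype.ext (HomogeneousSpec.ideal_injective (le_antisymm hqp hpq))
      exact le_sup_right.trans le_sup_left
    · exact (F q).2.2.trans ((le_inf (gammaImage_le_rightOrthogonal_primesAbove hT hpq)
        (gammaImage_le_rightOrthogonal_primesNotBelow hT hqp)).trans le_sup_right)
  · exact (F q).2.2.trans ((gammaImage_le_torsion_primesNotBelow hqp).trans
      (le_sup_left.trans le_sup_left))

lemma loc_iSup_inf_gammaImage_eq [IsTriangulated T] [IsNoetherianRing R]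
    (hT : CompactlyGenerated T)
    (F : (q : supp ρ) → LocalisingSubcategoryOf (gammaImage ρ q.1)) (p : supp ρ) :
    loc (⨆ q, (F q).1) ⊓ gammaImage ρ p.1 = (F p).1 := by
  refine le_antisymm ?_ (le_inf ((le_iSup (fun q => (F q).1) p).trans (le_loc _)) (F p).2.2)
  calc loc (⨆ q, (F q).1) ⊓ gammaImage ρ p.1
    _ ≤ _ ⊓ (torsion ρ (primesAbove p.1) ⊓ (torsion ρ (primesNotBelow p.1)).rightOrthogonal) :=
      inf_le_inf (loc_mono (iSup_le_torsion_sup_rightOrthogonal hT F p)) hT.gammaImage_eq.le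
    _ ≤ (F p).1 := loc_sup_inf_le (isLocalising_torsion ρ _) (isLocalising_torsion ρ _)
      ((hT.isLocalising_rightOrthogonal_primesAbove ρ p.1).inf
        (hT.isLocalising_rightOrthogonal_primesNotBelow ρ p.1)) (F p).2.1
      ((F p).2.2.trans_eq hT.gammaImage_eq) le_rfl

end Stratification

end RLinearTriangulated

open RLinearTriangulated in
theorem mainTheorem8_general
    {T : Type u} [Category.{v} T] [Preadditive T] [HasZeroObject T] [HasShift T ℤ]
    [∀ n : ℤ, (shiftFunctor T n).Additive] [Pretriangulated T] [IsTriangulated T]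
    [HasCoproducts.{v} T] (hT : CompactlyGenerated T)
    {R : Type w} [Ring R] (𝒜 : ℤ → AddSubgroup R) [GradedRing 𝒜] [IsNoetherianRing R]
    (ρ : CentralAction T 𝒜) (hlg : LocalGlobalPrinciple ρ) :
    ∃ σ : LocalisingSubcategory T ≃o
        ((p : supp ρ) → LocalisingSubcategoryOf (gammaImage ρ p.1)),
      (∀ (S : LocalisingSubcategory T) (p : supp ρ), (σ S p).1 = S.1 ⊓ gammaImage ρ p.1) ∧
      (∀ F : (p : supp ρ) → LocalisingSubcategoryOf (gammaImage ρ p.1),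
        (σ.symm F).1 = loc (⨆ p, (F p).1)) := by
  let σ (S : LocalisingSubcategory T) (p : supp ρ) : LocalisingSubcategoryOf (gammaImage ρ p.1) :=
    ⟨S.1 ⊓ gammaImage ρ p.1, S.2.inf (hT.isLocalising_gammaImage ρ p.1), inf_le_right⟩
  let τ (F : (p : supp ρ) → LocalisingSubcategoryOf (gammaImage ρ p.1)) :
      LocalisingSubcategory T := ⟨loc (⨆ p, (F p).1), isLocalising_loc _⟩
  have hσ : Monotone σ := fun S S' h p => inf_le_inf_right (gammaImage ρ p.1) h
  have hτ : Monotone τ := fun F F' h => loc_mono (iSup_mono h)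
  have hτσ (S : LocalisingSubcategory T) : τ (σ S) = S :=
    Subtype.ext (loc_iSup_inf_gammaImage hlg S.2)
  have hστ (F : (p : supp ρ) → LocalisingSubcategoryOf (gammaImage ρ p.1)) : σ (τ F) = F :=
    funext fun p => Subtype.ext (loc_iSup_inf_gammaImage_eq hT F p)
  exact ⟨Equiv.toOrderIso ⟨σ, τ, hτσ, hστ⟩ hσ hτ, fun _ _ => rfl, fun _ => rfl⟩

theorem mainTheorem8
    {T : Type u} [Category.{v} T] [Preadditive T] [HasZeroObject T] [HasShift T ℤ]
    [∀ n : ℤ, (shiftFunctor T n).Additive] [Pretriangulated T] [IsTriangulated T]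
    [HasCoproducts.{v} T]
    (hT : RLinearTriangulated.CompactlyGenerated T)
    {R : Type w} [Ring R] (𝒜 : ℤ → AddSubgroup R) [GradedRing 𝒜]
    (hcomm : RLinearTriangulated.GradedCommutative 𝒜) [IsNoetherianRing R]
    (ρ : RLinearTriangulated.CentralAction T 𝒜)
    (hlg : RLinearTriangulated.LocalGlobalPrinciple ρ) :
    ∃ σ : RLinearTriangulated.LocalisingSubcategory T ≃o
        ((p : RLinearTriangulated.supp ρ) →
          RLinearTriangulated.LocalisingSubcategoryOf (RLinearTriangulated.gammaImage ρ p.1)),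
      (∀ (S : RLinearTriangulated.LocalisingSubcategory T) (p : RLinearTriangulated.supp ρ),
        (σ S p).1 = S.1 ⊓ RLinearTriangulated.gammaImage ρ p.1) ∧
      (∀ F : (p : RLinearTriangulated.supp ρ) →
          RLinearTriangulated.LocalisingSubcategoryOf (RLinearTriangulated.gammaImage ρ p.1),
        (σ.symm F).1 = RLinearTriangulated.loc (⨆ p, (F p).1)) :=
  mainTheorem8_general hT 𝒜 ρ hlg
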